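/- Let $\Omega$ be a finite lattice, i.e. a finite metric space of sites, with a finite-dimensional Hilbert space $\mathcal H_x=\mathbb C^{d_x}$ at each site and $\mathcal H_\Omega=\bigotimes_{x\in\Omega}\mathcal H_x$. Let $H=\sum_{Z\subseteq\Omega}h_Z$ be a Hamiltonian with a finite-range interaction: $h_Z$ is a self-adjoint operator on $\mathcal H_\Omega$ supported in $Z$, with $\|h_Z\|\le J$ and with $h_Z=0$ if $Z$ contains two sites at distance larger than $R$; suppose that every closed ball of radius $R$ contains at most $N$ sites. Let $\rho(0)=\bigotimes_{x\in\Omega}\rho_x$ be a product of density matrices, and $\rho(t)=e^{-itH}\rho(0)e^{itH}$ for $t\ge 0$. For $n\ge2$ parties with finite-dimensional Hilbert spaces $\mathcal H_1,\dots,\mathcal H_n$ and finitely many inputs each, and real coefficients $\psi=(\psi^{(i_1\cdots i_s)}_{k_1\cdots k_s})$, put $$\mathcal S(\sigma,E)=\sum_{s=1}^n\ \sum_{i_1,\dots,i_s\text{ distinct}}\ \sum_{k_1,\dots,k_s}\psi^{(i_1\cdots i_s)}_{k_1\cdots k_s}\,\mathrm{tr}\bigl(E^{(i_1)}_{k_1}\otimes\cdots\otimes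 E^{(i_s)}_{k_s}\otimes \mathbb 1\;\sigma\bigr),\qquad \mathcal S(\sigma)=\sup_E\mathcal S(\sigma,E),$$ the supremum being over all self-adjoint $E^{(i)}_{k}$ on $\mathcal H_i$ with $\|E^{(i)}_{k}\|\le1$. A state on $\mathcal H_1\otimes\cdots\otimes\mathcal H_n$ is biseparable if it is a convex combination of states, each of which is a convex combination of product states with respect to some partition of the parties into $k\ge2$ nonempty blocks. Let $\Delta_{loc}$ be the supremum of $\mathcal S(\sigma)$ over the biseparable states $\sigma$. A state $\sigma$ is $\varepsilon$-local for the inequality $\mathcal S\le\Delta_{loc}$ if $\mathcal S(\sigma)\le\Delta_{loc}+\varepsilon$. Then there are constants $c,\kappa,v>0$, depending only on $N$, $R$ and $J$, such that for every such system, every $t\ge0$, every $n\ge2$, all pairwise disjoint nonempty regions $X_1,\dots,X_n\subseteq\Omega$, and all coefficients $\psi$ (for any finite numbers of inputs), the state of the regions at time $t$ (the partial trace of $\rho(t)$ over the other sites, as an $n$-partite state on $\mathcal H_{X_1}\otimes\cdots\otimes\mathcal H_{X_n}$) is $\varepsilon$-local with $$\varepsilon=\hat\mu\,c\,e^{-\kappa\tau}\bigl(e^{\kappa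 v t}-1\bigr),\qquad \hat\mu=\sum_{s=1}^n\ \sum_{i_1,\dots,i_s\text{ distinct}}\ \sum_{k_1,\dots,k_s}\Bigl(\prod_{j=1}^s|X_{i_j}|\Bigr)\bigl|\psi^{(i_1\cdots i_s)}_{k_1\cdots k_s}\bigr|,$$ where $\tau=\min_{i\ne j}\min_{x\in X_i,\,y\in X_j}d(x,y)$. -/

import Mathlib

open scoped Matrix.Norms.L2Operator ComplexOrder

namespace SpinBell

/-! ### States -/

/-- A density matrix: positive semidefinite with trace one. -/
def IsDensity {ι : Type*} [Fintype ι] (ρ : Matrix ι ι ℂ) : Prop :=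
  ρ.PosSemidef ∧ ρ.trace = 1

/-! ### `n`-partite Bell scenarios

Party `i` has the Hilbert space with orthonormal basis `P i`; the tensor product of all the
party spaces has the basis `∀ i, P i`. Party `i` has the inputs `Fin (m i)`. All matrix norms
are operator norms for the Euclidean norm. -/

section Bell

/-- The `k`-partite product state `⊗_b τ_b` with respect to the partition of the parties into the
blocks `f ⁻¹ {b}`, `b : Fin k`. -/
def blockProduct {n : ℕ} (P : Fin n → Type) {k : ℕ} (f : Fin n → Fin k)
    (τ : ∀ b : Fin k, Matrix (∀ i : {i : Fin n // f i = b}, P i)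
      (∀ i : {i : Fin n // f i = b}, P i) ℂ) :
    Matrix (∀ i, P i) (∀ i, P i) ℂ :=
  Matrix.of fun p q => ∏ b : Fin k, τ b (fun i => p i) (fun i => q i)

/-- The separable states with respect to the partition of the parties given by `f`: mixtures of
product states over the blocks. -/
def separableStates {n : ℕ} (P : Fin n → Type) [∀ i, Fintype (P i)] {k : ℕ}
    (f : Fin n → Fin k) : Set (Matrix (∀ i, P i) (∀ i, P i) ℂ) :=
  convexHull ℝ {σ | ∃ τ : ∀ b : Fin k, Matrix (∀ i : {i : Fin n // f i = b}, P i)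
    (∀ i : {i : Fin n // f i = b}, P i) ℂ, (∀ b, IsDensity (τ b)) ∧ σ = blockProduct P f τ}

/-- The biseparable states: mixtures of states each of which is separable with respect to some
partition of the parties into `k ≥ 2` nonempty blocks. -/
def biseparableStates {n : ℕ} (P : Fin n → Type) [∀ i, Fintype (P i)] :
    Set (Matrix (∀ i, P i) (∀ i, P i) ℂ) :=
  convexHull ℝ {σ | ∃ k : ℕ, 2 ≤ k ∧ ∃ f : Fin n → Fin k, Function.Surjective f ∧
    σ ∈ separableStates P f}

/-- A choice of observables of norm at most one, for each party and each input. -/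
def IsObservableFamily {n : ℕ} (P : Fin n → Type) [∀ i, Fintype (P i)]
    [∀ i, DecidableEq (P i)] {m : Fin n → ℕ}
    (E : ∀ i : Fin n, Fin (m i) → Matrix (P i) (P i) ℂ) : Prop :=
  ∀ i k, (E i k).IsHermitian ∧ ‖E i k‖ ≤ 1

open Classical in
/-- The operator `E^{(i₁)}_{k₁} ⊗ ⋯ ⊗ E^{(i_s)}_{k_s} ⊗ 1` on the whole tensor product, for the
tuple `I = (i₁, …, i_s)` of distinct parties and their inputs `k = (k₁, …, k_s)`. -/
noncomputable def correlatorOp {n : ℕ} (P : Fin n → Type) {m : Fin n → ℕ}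
    (E : ∀ i : Fin n, Fin (m i) → Matrix (P i) (P i) ℂ)
    {s : ℕ} (I : Fin s ↪ Fin n) (k : ∀ j, Fin (m (I j))) :
    Matrix (∀ i, P i) (∀ i, P i) ℂ :=
  Matrix.of fun p q => if ∀ i, (∀ j, I j ≠ i) → p i = q i then
    ∏ j, E (I j) (k j) (p (I j)) (q (I j)) else 0

/-- The correlator `⟨E^{(i₁)}_{k₁} ⋯ E^{(i_s)}_{k_s}⟩_σ`. -/
noncomputable def correlator {n : ℕ} (P : Fin n → Type) [∀ i, Fintype (P i)] {m : Fin n → ℕ}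
    (E : ∀ i : Fin n, Fin (m i) → Matrix (P i) (P i) ℂ)
    (σ : Matrix (∀ i, P i) (∀ i, P i) ℂ)
    {s : ℕ} (I : Fin s ↪ Fin n) (k : ∀ j, Fin (m (I j))) : ℝ :=
  (Matrix.trace (correlatorOp P E I k * σ)).re

/-- The real coefficients `ψ^{(i₁ ⋯ i_s)}_{k₁ ⋯ k_s}` of a linear Bell expression. -/
abbrev BellCoeff (n : ℕ) (m : Fin n → ℕ) : Type :=
  ∀ s : ℕ, ∀ I : Fin s ↪ Fin n, (∀ j, Fin (m (I j))) → ℝ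

/-- The Bell expression
`∑_{s = 1}^n ∑_{i₁, …, i_s distinct} ∑_k ψ^{(i)}_k ⟨E^{(i₁)}_{k₁} ⋯ E^{(i_s)}_{k_s}⟩_σ`. -/
noncomputable def bellExpr {n : ℕ} (P : Fin n → Type) [∀ i, Fintype (P i)] {m : Fin n → ℕ}
    (ψ : BellCoeff n m) (σ : Matrix (∀ i, P i) (∀ i, P i) ℂ)
    (E : ∀ i : Fin n, Fin (m i) → Matrix (P i) (P i) ℂ) : ℝ :=
  ∑ s ∈ Finset.Icc 1 n, ∑ I : Fin s ↪ Fin n, ∑ k : (∀ j, Fin (m (I j))),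
    ψ s I k * correlator P E σ I k

/-- The values of the Bell expression on the state `σ`, over all choices of observables. -/
def bellValues {n : ℕ} (P : Fin n → Type) [∀ i, Fintype (P i)] [∀ i, DecidableEq (P i)]
    {m : Fin n → ℕ} (ψ : BellCoeff n m) (σ : Matrix (∀ i, P i) (∀ i, P i) ℂ) : Set ℝ :=
  {r | ∃ E : ∀ i : Fin n, Fin (m i) → Matrix (P i) (P i) ℂ,
    IsObservableFamily P E ∧ r = bellExpr P ψ σ E}

/-- `Bell expression ≤ Δ` is a valid biseparability inequality: it holds for every biseparable
state and every choice of observables. -/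
def IsBiseparabilityInequality {n : ℕ} (P : Fin n → Type) [∀ i, Fintype (P i)]
    [∀ i, DecidableEq (P i)] {m : Fin n → ℕ} (ψ : BellCoeff n m) (Δ : ℝ) : Prop :=
  ∀ σ ∈ biseparableStates P, ∀ r ∈ bellValues P ψ σ, r ≤ Δ

/-- The state `σ` is `ε`-local for the Bell expression `ψ`: the supremum of its values exceeds no
biseparable bound `Δ` (in particular not the least one) by more than `ε`. -/
def IsEpsLocal {n : ℕ} (P : Fin n → Type) [∀ i, Fintype (P i)] [∀ i, DecidableEq (P i)]
    {m : Fin n → ℕ} (ψ : BellCoeff n m) (σ : Matrix (∀ i, P i) (∀ i, P i) ℂ) (ε : ℝ) : Prop :=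
  ∀ Δ : ℝ, IsBiseparabilityInequality P ψ Δ →
    BddAbove (bellValues P ψ σ) ∧ sSup (bellValues P ψ σ) ≤ Δ + ε

end Bell

/-! ### Quantum spin systems

The site `x` of the finite lattice `Ω` carries the Hilbert space `ℂ ^ d x`. -/

section Lattice

/-- The standard basis of the Hilbert space of the lattice. -/
abbrev Config {Ω : Type*} (d : Ω → ℕ) : Type _ := ∀ x, Fin (d x)

open Classical in
/-- `A` is supported in `Z`, that is, `A = B ⊗ 1` for an operator `B` on the sites of `Z`. -/
def IsSupportedIn {Ω : Type*} {d : Ω → ℕ} (Z : Finset Ω)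
    (A : Matrix (Config d) (Config d) ℂ) : Prop :=
  ∃ B : Matrix (∀ x : Z, Fin (d x)) (∀ x : Z, Fin (d x)) ℂ,
    ∀ p q, A p q = if ∀ x, x ∉ Z → p x = q x then B (fun x => p x) (fun x => q x) else 0

/-- An interaction on the lattice: `h Z` is a self-adjoint operator supported in `Z` with
`‖h Z‖ ≤ J`, which vanishes unless all the sites of `Z` are within distance `R` of each other. -/
structure IsInteraction {Ω : Type*} [Fintype Ω] [DecidableEq Ω] [MetricSpace Ω] {d : Ω → ℕ}
    (R J : ℝ) (h : Finset Ω → Matrix (Config d) (Config d) ℂ) : Prop where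
  hermitian : ∀ Z, (h Z).IsHermitian
  supported : ∀ Z, IsSupportedIn Z (h Z)
  range : ∀ Z, (∃ x ∈ Z, ∃ y ∈ Z, R < dist x y) → h Z = 0
  strength : ∀ Z, ‖h Z‖ ≤ J

/-- The Hamiltonian `H = ∑_Z h Z`. -/
def hamiltonian {Ω : Type*} [Fintype Ω] [DecidableEq Ω] {d : Ω → ℕ}
    (h : Finset Ω → Matrix (Config d) (Config d) ℂ) : Matrix (Config d) (Config d) ℂ :=
  ∑ Z : Finset Ω, h Z

/-- The product state `⊗_x ρ_x`. -/
def productState {Ω : Type*} [Fintype Ω] {d : Ω → ℕ}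
    (ρ : ∀ x, Matrix (Fin (d x)) (Fin (d x)) ℂ) : Matrix (Config d) (Config d) ℂ :=
  Matrix.of fun p q => ∏ x, ρ x (p x) (q x)

/-- The evolved state `e^{-itH} ρ e^{itH}`. -/
noncomputable def evolve {Ω : Type*} [Fintype Ω] [DecidableEq Ω] {d : Ω → ℕ}
    (H : Matrix (Config d) (Config d) ℂ) (t : ℝ) (ρ : Matrix (Config d) (Config d) ℂ) :
    Matrix (Config d) (Config d) ℂ :=
  NormedSpace.exp ((-(Complex.I * (t : ℂ))) • H) * ρ * NormedSpace.exp ((Complex.I * (t : ℂ)) • H)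

/-- The standard basis of the Hilbert space of the region `X i`, the space of party `i`. -/
abbrev RegionConfig {Ω : Type} (d : Ω → ℕ) {n : ℕ} (X : Fin n → Finset Ω) (i : Fin n) : Type :=
  ∀ x : X i, Fin (d x)

open Classical in
/-- The state of the regions `X 0, …, X (n - 1)` (pairwise disjoint) as an `n`-partite state: the
partial trace of `ρ` over all the other sites. -/
noncomputable def regionState {Ω : Type} [Fintype Ω] [DecidableEq Ω] {d : Ω → ℕ} {n : ℕ}
    (X : Fin n → Finset Ω) (ρ : Matrix (Config d) (Config d) ℂ) :
    Matrix (∀ i, RegionConfig d X i) (∀ i, RegionConfig d X i) ℂ :=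
  Matrix.of fun p q => ∑ a : Config d, ∑ b : Config d,
    if (∀ i, ∀ x : X i, a x = p i x ∧ b x = q i x) ∧
      (∀ x, (∀ i, x ∉ X i) → a x = b x) then ρ a b else 0

/-- The distance between two nonempty regions. -/
noncomputable def regionDist {Ω : Type*} [MetricSpace Ω] (X Y : Finset Ω) : ℝ :=
  sInf {r | ∃ x ∈ X, ∃ y ∈ Y, r = dist x y}

/-- The least distance between two of the `n ≥ 2` regions. -/
noncomputable def minRegionDist {Ω : Type*} [MetricSpace Ω] {n : ℕ} (X : Fin n → Finset Ω) : ℝ :=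
  sInf {r | ∃ i j, i ≠ j ∧ r = regionDist (X i) (X j)}

/-- The constant
`∑_{s = 1}^n ∑_{i₁, …, i_s distinct} ∑_k (|X_{i₁}| ⋯ |X_{i_s}|) |ψ^{(i₁ ⋯ i_s)}_{k₁ ⋯ k_s}|`. -/
noncomputable def muHat {Ω : Type*} {n : ℕ} {m : Fin n → ℕ} (X : Fin n → Finset Ω)
    (ψ : BellCoeff n m) : ℝ :=
  ∑ s ∈ Finset.Icc 1 n, ∑ I : Fin s ↪ Fin n, ∑ k : (∀ j, Fin (m (I j))),
    (∏ j, ((X (I j)).card : ℝ)) * |ψ s I k|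

end Lattice

end SpinBell

/-! Fix the smallest region `X i₀` and let `L` be its `r`th layer, with `r` about `τ / (2 R')`.
Deleting the interaction terms that meet both `L` and its complement leaves two commuting
Hamiltonians, one on each side, so the initial product state evolves into a product over `L` and its
complement (`evolve_productState_eq`). Since `X i₀` lies inside `L` and all other regions lie
outside, the reduced state of the regions is then a product over two blocks of parties, hence
biseparable (`regionState_mem_biseparableStates`).

It remains to compare correlators under the true and the cut dynamics. In the Heisenberg picture,
Duhamel's formula (`norm_flow_sub_flow_le`) bounds the difference by commutators of the deleted
terms with the evolved observable `O`. The support of `O` lies in `X i₀` and beyond layer `2 r - 1`,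
so the deleted terms are about `r` steps away from it on either side. The Lieb–Robinson estimate
(`norm_commutator_flow_le`) gives each commutator a factor `b ^ (-(r - 1))`. It evolves the small
term rather than `O`, so only `‖O‖` enters, not the size of its support.

There are at most `|X i₀| (N + 1) ^ r 2 ^ N` deleted terms. With `b = (N + 1) e` the growth `(N + 1)
^ r` is absorbed and `e ^ (-r)` survives, which is the decay in `τ`. Minimality of `|X i₀|` bounds
it by every product of region sizes in `muHat`. One biseparable state serves all correlators, so the
estimates can be summed against the coefficients. -/

namespace SpinBell

/-! ### Inner flows on a C*-algebra: Lieb–Robinson and Duhamel estimates -/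

section Flow

open NormedSpace

variable {A : Type*} [CStarAlgebra A]

/-- The inner flow `x ↦ e^{tG} x e^{-tG}` generated by `G`. -/
noncomputable def flow (G : A) (t : ℝ) (x : A) : A := exp (t • G) * x * exp ((-t) • G)

theorem exp_smul_mul_exp_neg_smul (G : A) (t : ℝ) : exp (t • G) * exp ((-t) • G) = 1 := by
  let _ : NormedAlgebra ℚ A := NormedAlgebra.restrictScalars ℚ ℝ A
  rw [← exp_add_of_commute (((Commute.refl G).smul_left t).smul_right (-t)), ← add_smul]
  simp

theorem exp_neg_smul_mul_exp_smul (G : A) (t : ℝ) : exp ((-t) • G) * exp (t • G) = 1 := by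
  simpa using exp_smul_mul_exp_neg_smul G (-t)

theorem flow_mul (G : A) (t : ℝ) (x y : A) : flow G t (x * y) = flow G t x * flow G t y := by
  simp only [flow]
  calc _ = exp (t • G) * x * 1 * y * exp ((-t) • G) := by simp [mul_assoc]
    _ = _ := by rw [← exp_neg_smul_mul_exp_smul G t]; simp only [mul_assoc]

theorem flow_sub (G : A) (t : ℝ) (x y : A) : flow G t (x - y) = flow G t x - flow G t y := by
  simp [flow, mul_sub, sub_mul]

theorem flow_sum {ι : Type*} (G : A) (t : ℝ) (s : Finset ι) (x : ι → A) :
    flow G t (∑ i ∈ s, x i) = ∑ i ∈ s, flow G t (x i) := by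
  simp [flow, Finset.mul_sum, Finset.sum_mul]

@[simp] theorem flow_zero (G : A) (t : ℝ) : flow G t 0 = 0 := by simp [flow]

@[simp] theorem flow_zero_time (G x : A) : flow G 0 x = x := by simp [flow]

theorem flow_neg_generator (G : A) (t : ℝ) (x : A) : flow (-G) t x = flow G (-t) x := by
  simp [flow]

theorem flow_flow_neg (G : A) (t : ℝ) (x : A) : flow G t (flow G (-t) x) = x := by
  simp only [flow, neg_neg]
  calc _ = (exp (t • G) * exp ((-t) • G)) * x * (exp (t • G) * exp ((-t) • G)) := by
        simp only [mul_assoc]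
    _ = x := by rw [exp_smul_mul_exp_neg_smul, one_mul, mul_one]

theorem norm_flow {G : A} (hG : G ∈ skewAdjoint A) (t : ℝ) (x : A) : ‖flow G t x‖ = ‖x‖ := by
  let _ : NormedAlgebra ℚ A := NormedAlgebra.restrictScalars ℚ ℝ A
  have h (s : ℝ) : exp (s • G) ∈ unitary A :=
    exp_mem_unitary_of_mem_skewAdjoint (skewAdjoint.smul_mem s hG)
  rw [flow, CStarRing.norm_mul_mem_unitary _ (h _), CStarRing.norm_mem_unitary_mul _ (h _)]

theorem hasDerivAt_exp_neg_smul (G : A) (t : ℝ) :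
    HasDerivAt (fun s : ℝ => exp ((-s) • G)) (-(G * exp ((-t) • G))) t := by
  have := (hasDerivAt_exp_smul_const' (𝕂 := ℝ) G (-t)).scomp t (hasDerivAt_neg t)
  simpa [Function.comp_def] using this

theorem hasDerivAt_flow (G : A) (t : ℝ) (x : A) :
    HasDerivAt (fun s => flow G s x) (flow G t (G * x - x * G)) t := by
  have := ((hasDerivAt_exp_smul_const (𝕂 := ℝ) G t).mul_const x).mul (hasDerivAt_exp_neg_smul G t)
  refine this.congr_deriv ?_
  simp only [flow]
  noncomm_ring

theorem norm_commutator_le (x y : A) : ‖x * y - y * x‖ ≤ 2 * ‖x‖ * ‖y‖ := by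
  calc _ ≤ ‖x * y‖ + ‖y * x‖ := norm_sub_le _ _
    _ ≤ ‖x‖ * ‖y‖ + ‖y‖ * ‖x‖ := add_le_add (norm_mul_le _ _) (norm_mul_le _ _)
    _ = _ := by ring

/-- Lieb–Robinson bound for a generator `∑ Z, g Z` whose terms interact only along the relation
`r`, in terms of a function `D` that changes by at most one along `r`. -/
theorem norm_commutator_flow_le {ι : Type*} [Fintype ι] (g : ι → A) (r : ι → ι → Prop)
    (hskew : ∀ Z, g Z ∈ skewAdjoint A) {J : ℝ} (hJ : ∀ Z, ‖g Z‖ ≤ J)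
    (hcomm : ∀ Z W, ¬ r Z W → g W * g Z = g Z * g W) {K : ℕ}
    (hK : ∀ Z, g Z ≠ 0 → {W | r Z W ∧ g W ≠ 0}.ncard ≤ K) (D : ι → ℕ)
    (hD : ∀ Z W, g Z ≠ 0 → g W ≠ 0 → r Z W → D Z ≤ D W + 1) (O : A)
    (hO : ∀ Z, D Z ≠ 0 → g Z * O = O * g Z) {b : ℝ} (hb : 1 ≤ b)
    {t : ℝ} (ht : 0 ≤ t) (Z : ι) :
    ‖flow (∑ Z, g Z) t (g Z) * O - O * flow (∑ Z, g Z) t (g Z)‖ ≤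
      2 * J * ‖O‖ * (b ^ D Z)⁻¹ * Real.exp (4 * J * K * b * t) := by
  classical
  set G := ∑ Z, g Z with hG
  have hGs : G ∈ skewAdjoint A := sum_mem fun Z _ => hskew Z
  have hJ0 : 0 ≤ J := (norm_nonneg _).trans (hJ Z)
  have hb0 : 0 < b := by linarith
  let P : ℝ → ι → A := fun s Z => flow G s (g Z)
  let C : ℝ → ι → A := fun s Z => P s Z * O - O * P s Z
  let P' : ℝ → ι → A := fun s Z => flow G s (G * g Z - g Z * G)
  -- Weighting by `b ^ D Z` builds the spatial decay into the sup norm over `Z`: Grönwall for the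
  -- whole family then yields the factor `(b ^ D Z)⁻¹`. At time zero only terms with `D Z = 0`
  -- contribute.
  let F : ℝ → ι → A := fun s Z => (b ^ D Z) • C s Z
  let F' : ℝ → ι → A := fun s Z => (b ^ D Z) • (P' s Z * O - O * P' s Z)
  have hPn (s Z) : ‖P s Z‖ ≤ J := by simpa [P, norm_flow hGs] using hJ Z
  have hF (s) : HasDerivAt F (F' s) s := by
    refine hasDerivAt_pi.2 fun Z => ?_
    have h := hasDerivAt_flow G s (g Z)
    exact ((h.mul_const O).sub (h.const_mul O)).const_smul (b ^ D Z)
  have h0 : ‖F 0‖ ≤ 2 * J * ‖O‖ := by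
    refine (pi_norm_le_iff_of_nonneg (by positivity)).2 fun Z => ?_
    simp only [F, C, P, flow_zero_time]
    by_cases h : D Z = 0
    · simp only [h, pow_zero, one_smul]
      refine (norm_commutator_le _ _).trans ?_
      gcongr
      exact hJ Z
    · rw [hO Z h, sub_self, smul_zero, norm_zero]
      positivity
  have hP' (s Z) : P' s Z = ∑ W with r Z W ∧ g W ≠ 0, (P s W * P s Z - P s Z * P s W) := by
    have : G * g Z - g Z * G = ∑ W with r Z W ∧ g W ≠ 0, (g W * g Z - g Z * g W) := by
      rw [Finset.sum_filter_of_ne, hG, Finset.sum_mul, Finset.mul_sum, Finset.sum_sub_distrib]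
      intro W _ h
      constructor
      · by_contra hr
        exact h (sub_eq_zero.2 (hcomm Z W hr))
      · rintro h'
        simp [h'] at h
    simp only [P', P]
    rw [this]
    simp only [flow_sum, flow_sub, flow_mul]
  have hCF (s W) : b ^ D W * ‖C s W‖ ≤ ‖F s‖ := by
    refine le_trans (le_of_eq ?_) (norm_le_pi_norm (F s) W)
    simp [F, norm_smul, abs_of_pos hb0]
  have hF' (s) : ‖F' s‖ ≤ (4 * J * K * b) * ‖F s‖ + 0 := by
    rw [add_zero]
    refine (pi_norm_le_iff_of_nonneg (by positivity)).2 fun Z => ?_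
    by_cases hZ : g Z = 0
    · simp only [F', P', hZ, mul_zero, zero_mul, sub_self, flow_zero, smul_zero, norm_zero]
      positivity
    have hterm : ∀ W ∈ Finset.univ.filter (fun W => r Z W ∧ g W ≠ 0),
        b ^ D Z * ‖(P s W * P s Z - P s Z * P s W) * O - O * (P s W * P s Z - P s Z * P s W)‖ ≤
          4 * J * b * ‖F s‖ := by
      intro W hW
      obtain ⟨hr, hW0⟩ := (Finset.mem_filter.1 hW).2
      -- Jacobi identity: the derivative is expressed through the commutators `C` themselves, which
      -- closes the differential inequality.
      have h1 : (P s W * P s Z - P s Z * P s W) * O - O * (P s W * P s Z - P s Z * P s W) =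
          (P s W * C s Z - C s Z * P s W) + (C s W * P s Z - P s Z * C s W) := by
        simp only [C]; noncomm_ring
      have h2 : ‖(P s W * P s Z - P s Z * P s W) * O - O * (P s W * P s Z - P s Z * P s W)‖ ≤
          2 * J * ‖C s Z‖ + 2 * J * ‖C s W‖ := by
        rw [h1]
        refine (norm_add_le _ _).trans (add_le_add ?_ ?_)
        · refine (norm_commutator_le _ _).trans ?_
          gcongr
          exact hPn s W
        · rw [norm_sub_rev]
          refine (norm_commutator_le _ _).trans ?_
          gcongr
          exact hPn s Z
      have h3 : b ^ D Z * ‖C s W‖ ≤ b * ‖F s‖ := by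
        calc b ^ D Z * ‖C s W‖ ≤ b ^ (D W + 1) * ‖C s W‖ := by
              gcongr
              exacts [hD Z W hZ hW0 hr]
          _ = b * (b ^ D W * ‖C s W‖) := by ring
          _ ≤ b * ‖F s‖ := by gcongr; exact hCF s W
      have h4 : b ^ D Z * ‖C s Z‖ ≤ b * ‖F s‖ :=
        (hCF s Z).trans (le_mul_of_one_le_left (norm_nonneg _) hb)
      calc _ ≤ b ^ D Z * (2 * J * ‖C s Z‖ + 2 * J * ‖C s W‖) := by gcongr
        _ = 2 * J * (b ^ D Z * ‖C s Z‖) + 2 * J * (b ^ D Z * ‖C s W‖) := by ring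
        _ ≤ 2 * J * (b * ‖F s‖) + 2 * J * (b * ‖F s‖) := by gcongr
        _ = _ := by ring
    simp only [F', norm_smul, norm_pow, Real.norm_eq_abs, abs_of_pos hb0]
    rw [hP', Finset.sum_mul, Finset.mul_sum, ← Finset.sum_sub_distrib]
    calc _ ≤ b ^ D Z * ∑ W with r Z W ∧ g W ≠ 0,
          ‖(P s W * P s Z - P s Z * P s W) * O - O * (P s W * P s Z - P s Z * P s W)‖ := by
          gcongr
          exact norm_sum_le _ _
      _ ≤ ∑ W with r Z W ∧ g W ≠ 0, 4 * J * b * ‖F s‖ := by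
          rw [Finset.mul_sum]
          exact Finset.sum_le_sum hterm
      _ = ({W | r Z W ∧ g W ≠ 0}.ncard : ℝ) * (4 * J * b * ‖F s‖) := by
          rw [Finset.sum_const, nsmul_eq_mul, Set.ncard_eq_toFinset_card']
          congr 3
          ext; simp
      _ ≤ K * (4 * J * b * ‖F s‖) := by gcongr; exact hK Z hZ
      _ = _ := by ring
  have := norm_le_gronwallBound_of_norm_deriv_right_le (a := 0) (b := t)
    (fun s _ => (hF s).continuousAt.continuousWithinAt)
    (fun s _ => (hF s).hasDerivWithinAt) h0 (fun s _ => hF' s) t ⟨ht, le_rfl⟩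
  rw [gronwallBound_ε0, sub_zero] at this
  have h5 := (hCF t Z).trans this
  rw [mul_right_comm _ _ (Real.exp _), ← div_eq_mul_inv, le_div_iff₀ (by positivity), mul_comm]
  exact h5

/-- Comparison of two flows: Duhamel's formula. -/
theorem norm_flow_sub_flow_le {G G' : A} (hG' : G' ∈ skewAdjoint A)
    (O : A) {c V : ℝ} (hV : 0 < V)
    (h : ∀ s, 0 ≤ s → ‖(G - G') * flow G s O - flow G s O * (G - G')‖ ≤ c * Real.exp (V * s))
    {t : ℝ} (ht : 0 ≤ t) :
    ‖flow G t O - flow G' t O‖ ≤ c / V * (Real.exp (V * t) - 1) := by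
  -- Interaction picture: `G` forwards, then `G'` backwards, so only `G - G'` survives in the
  -- derivative. The outer flow is isometric and is undone at the end.
  let f : ℝ → A := fun s => flow G' (-s) (flow G s O) - O
  have hf (s) : HasDerivAt f
      (flow G' (-s) ((G - G') * flow G s O - flow G s O * (G - G'))) s := by
    have h1 := ((hasDerivAt_exp_neg_smul G' s).mul (hasDerivAt_flow G s O)).mul
      (hasDerivAt_exp_smul_const (𝕂 := ℝ) G' s)
    have h2 : f = fun s => exp ((-s) • G') * flow G s O * exp (s • G') - O := by
      funext s; simp only [f, flow, neg_neg]
    rw [h2]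
    refine (h1.sub_const O).congr_deriv ?_
    have h3 : flow G s (G * O - O * G) = G * flow G s O - flow G s O * G := by
      have hc (u : ℝ) : G * exp (u • G) = exp (u • G) * G :=
        (((Commute.refl G).smul_right u).exp_right).eq
      have : flow G s (G * O - O * G) = exp (s • G) * G * O * exp ((-s) • G) -
          exp (s • G) * O * (G * exp ((-s) • G)) := by
        simp only [flow]; noncomm_ring
      rw [this, hc, ← hc]; simp only [flow]; noncomm_ring
    have hc' (u : ℝ) : G' * exp (u • G') = exp (u • G') * G' :=
      (((Commute.refl G').smul_right u).exp_right).eq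
    rw [h3, ← hc' s, hc' (-s)]
    simp only [Pi.mul_apply, flow, neg_neg]
    noncomm_ring
  have hB (s : ℝ) : HasDerivAt (fun s => c / V * (Real.exp (V * s) - 1))
      (c * Real.exp (V * s)) s := by
    have := (((hasDerivAt_id s).const_mul V).exp.sub_const 1).const_mul (c / V)
    refine this.congr_deriv ?_
    simp only [id, mul_one]
    field_simp
  have := image_norm_le_of_norm_deriv_right_le_deriv_boundary (a := 0) (b := t) (f := f)
    (fun s _ => (hf s).continuousAt.continuousWithinAt) (fun s _ => (hf s).hasDerivWithinAt)
    (B := fun s => c / V * (Real.exp (V * s) - 1)) (by simp [f]) hB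
    (fun s hs => by rw [norm_flow hG']; exact h s hs.1) ⟨ht, le_rfl⟩
  rw [← norm_flow hG' t (f t), flow_sub, flow_flow_neg] at this
  exact this

end Flow

/-- Both decidability instances are arbitrary, so classical and structural ones can be matched. -/
theorem ite_congr_of_iff {γ : Type*} {P Q : Prop} {_ : Decidable P} {_ : Decidable Q} (h : P ↔ Q)
    (x y : γ) : (if P then x else y) = if Q then x else y := by
  by_cases hP : P
  · rw [if_pos hP, if_pos (h.1 hP)]
  · rw [if_neg hP, if_neg (mt h.2 hP)]

/-! ### Operators `M ⊗ 1` and partial traces for a factorized basis -/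

section Factorization

variable {C α β : Type*}

open Classical in
/-- The operator `M ⊗ 1` on a space with basis `C ≃ α × β`, the equivalence being given by the two
projections `f` and `g`. -/
noncomputable def emb (f : C → α) (g : C → β) (M : Matrix α α ℂ) : Matrix C C ℂ :=
  Matrix.of fun a b => if g a = g b then M (f a) (f b) else 0

variable {f : C → α} {g : C → β}

theorem sum_bijective [Fintype C] [Fintype α] [Fintype β] {E : Type*} [AddCommMonoid E]
    (hfg : Function.Bijective fun a => (f a, g a)) (F : α → β → E) :
    ∑ c, F (f c) (g c) = ∑ x, ∑ y, F x y := by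
  rw [← Fintype.sum_prod_type']
  exact hfg.sum_comp fun p => F p.1 p.2

theorem emb_mul [Fintype C] [Fintype α] [Fintype β]
    (hfg : Function.Bijective fun a => (f a, g a)) (M N : Matrix α α ℂ) :
    emb f g (M * N) = emb f g M * emb f g N := by
  classical
  ext a b
  simp only [emb, Matrix.of_apply, Matrix.mul_apply]
  rw [sum_bijective hfg fun x y => (if g a = y then M (f a) x else 0) *
    (if y = g b then N x (f b) else 0)]
  simp only [ite_mul, zero_mul, Finset.sum_ite_eq, Finset.mem_univ, if_true]
  split_ifs <;> simp

theorem emb_one [DecidableEq C] [DecidableEq α] (hfg : Function.Injective fun a => (f a, g a)) :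
    emb f g 1 = 1 := by
  ext a b
  have : a = b ↔ f a = f b ∧ g a = g b := by
    rw [← hfg.eq_iff, Prod.ext_iff]
  simp only [emb, Matrix.of_apply, Matrix.one_apply, this]
  split_ifs <;> simp_all

/-- `emb` as a homomorphism of star algebras. -/
noncomputable def embHom [Fintype C] [Fintype α] [Fintype β] [DecidableEq C] [DecidableEq α]
    (hfg : Function.Bijective fun a => (f a, g a)) : Matrix α α ℂ →⋆ₐ[ℂ] Matrix C C ℂ where
  toFun := emb f g
  map_one' := emb_one hfg.1
  map_mul' := emb_mul hfg
  map_zero' := by ext a b; simp [emb]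
  map_add' M N := by
    ext a b
    simp only [emb, Matrix.of_apply, Matrix.add_apply]
    split_ifs <;> simp
  commutes' r := by
    rw [Algebra.algebraMap_eq_smul_one, Algebra.algebraMap_eq_smul_one, ← emb_one hfg.1]
    ext a b
    simp [emb]
  map_star' M := by
    ext a b
    simp only [emb, Matrix.star_apply, Matrix.of_apply]
    by_cases h : g a = g b
    · simp [h]
    · simp [h, Ne.symm h]

/-- Star homomorphisms between C*-algebras are contractive. -/
theorem norm_emb_le [Fintype C] [Fintype α] [Fintype β] [DecidableEq C] [DecidableEq α]
    (hfg : Function.Bijective fun a => (f a, g a)) (M : Matrix α α ℂ) : ‖emb f g M‖ ≤ ‖M‖ :=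
  NonUnitalStarAlgHom.norm_apply_le (embHom hfg) M

theorem emb_exp [Fintype C] [Fintype α] [Fintype β] [DecidableEq C] [DecidableEq α]
    (hfg : Function.Bijective fun a => (f a, g a)) (M : Matrix α α ℂ) :
    emb f g (NormedSpace.exp M) = NormedSpace.exp (emb f g M) := by
  let _ : NormedAlgebra ℚ (Matrix α α ℂ) := NormedAlgebra.restrictScalars ℚ ℂ _
  let _ : NormedAlgebra ℚ (Matrix C C ℂ) := NormedAlgebra.restrictScalars ℚ ℂ _
  exact NormedSpace.map_exp (embHom hfg)
    (LinearMap.continuous_of_finiteDimensional (embHom hfg).toAlgHom.toLinearMap) M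

theorem emb_mul_emb_apply [Fintype C] [Fintype α] [Fintype β]
    (hfg : Function.Bijective fun a => (f a, g a)) (M : Matrix α α ℂ) (N : Matrix β β ℂ) (a b : C) :
    (emb f g M * emb g f N) a b = M (f a) (f b) * N (g a) (g b) := by
  classical
  simp only [emb, Matrix.of_apply, Matrix.mul_apply]
  rw [sum_bijective hfg fun x y => (if g a = y then M (f a) x else 0) *
    (if x = f b then N y (g b) else 0)]
  simp

theorem emb_comm_emb [Fintype C] [Fintype α] [Fintype β]
    (hfg : Function.Bijective fun a => (f a, g a)) (M : Matrix α α ℂ) (N : Matrix β β ℂ) :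
    Commute (emb f g M) (emb g f N) := by
  have hgf : Function.Bijective fun a => (g a, f a) :=
    (Equiv.prodComm α β).bijective.comp hfg
  ext a b
  rw [emb_mul_emb_apply hfg, emb_mul_emb_apply hgf, mul_comm]

/-- The partial trace over the second factor. -/
noncomputable def ptrace [Fintype C] [DecidableEq α] [DecidableEq β] (f : C → α) (g : C → β)
    (ρ : Matrix C C ℂ) : Matrix α α ℂ :=
  Matrix.of fun p q => ∑ a, ∑ b, if (f a = p ∧ f b = q) ∧ g a = g b then ρ a b else 0

theorem trace_mul_ptrace [Fintype C] [Fintype α] [DecidableEq α] [DecidableEq β]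
    (M : Matrix α α ℂ) (ρ : Matrix C C ℂ) :
    (M * ptrace f g ρ).trace = (emb f g M * ρ).trace := by
  simp only [Matrix.trace, Matrix.diag, Matrix.mul_apply, emb, ptrace, Matrix.of_apply]
  have h (p q : α) : M p q * (∑ a, ∑ b, if (f a = q ∧ f b = p) ∧ g a = g b then ρ a b else 0) =
      ∑ a, ∑ b, if p = f b then if q = f a then if g a = g b then M p q * ρ a b else 0 else 0
        else 0 := by
    simp only [Finset.mul_sum]
    refine Finset.sum_congr rfl fun a _ => Finset.sum_congr rfl fun b _ => ?_
    split_ifs <;> simp_all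
  simp only [h]
  calc _ = ∑ a, ∑ b, ∑ p, ∑ q, if p = f b then if q = f a then
        if g a = g b then M p q * ρ a b else 0 else 0 else 0 := by
        exact (Finset.sum_congr rfl fun p _ => Finset.sum_comm).trans (Finset.sum_comm.trans
          (Finset.sum_congr rfl fun a _ => (Finset.sum_congr rfl fun p _ => Finset.sum_comm).trans
            Finset.sum_comm))
    _ = ∑ a, ∑ b, if g a = g b then M (f b) (f a) * ρ a b else 0 := by
        simp
    _ = _ := by
        rw [Finset.sum_comm]
        refine Finset.sum_congr rfl fun a _ => Finset.sum_congr rfl fun b _ => ?_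
        simp [eq_comm]

/-- Positivity comes from the Kraus form `∑ c, K c * ρ * (K c)ᴴ`, where `K c` projects the second
factor onto the basis vector `c`; the trace comes from duality with `emb` at the identity. -/
theorem IsDensity.ptrace [Fintype C] [Fintype α] [Fintype β] [DecidableEq α] [DecidableEq β]
    (hfg : Function.Injective fun a => (f a, g a)) {ρ : Matrix C C ℂ} (hρ : IsDensity ρ) :
    IsDensity (ptrace f g ρ) := by
  classical
  constructor
  · let K : β → Matrix α C ℂ := fun c => Matrix.of fun p a => if f a = p ∧ g a = c then 1 else 0
    have : SpinBell.ptrace f g ρ = ∑ c, K c * ρ * (K c).conjTranspose := by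
      ext p q
      simp only [SpinBell.ptrace, Matrix.of_apply, Matrix.sum_apply, Matrix.mul_apply,
        Matrix.conjTranspose_apply, K, Finset.sum_mul]
      symm
      refine Finset.sum_comm.trans <| (Finset.sum_congr rfl fun b _ => Finset.sum_comm).trans <|
        Finset.sum_comm.trans <|
          Finset.sum_congr rfl fun a _ => Finset.sum_congr rfl fun b _ => ?_
      rw [Finset.sum_eq_single (g a) (fun c _ hc => by simp [Ne.symm hc]) (by simp)]
      by_cases h1 : f a = p <;> by_cases h2 : f b = q <;> by_cases h3 : g b = g a <;>
        simp [h1, h2, h3, @eq_comm _ (g a) (g b)]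
    rw [this]
    exact Matrix.posSemidef_sum _ fun c _ => hρ.1.mul_mul_conjTranspose_same _
  · have := trace_mul_ptrace (f := f) (g := g) 1 ρ
    rw [one_mul] at this
    rw [this, emb_one hfg, one_mul, hρ.2]

end Factorization

open scoped MatrixOrder in
theorem _root_.Matrix.PosSemidef.exists_eq_conjTranspose_mul_self {C : Type*} [Fintype C]
    [DecidableEq C] {M : Matrix C C ℂ} (hM : M.PosSemidef) :
    ∃ B : Matrix C C ℂ, M = B.conjTranspose * B :=
  CStarAlgebra.nonneg_iff_eq_star_mul_self.1 hM.nonneg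

/-! ### Tensor products over an index set -/

section PiKron

variable {ι : Type*} [Fintype ι] {κ : ι → Type*}

/-- The tensor product of one operator for each index. -/
def piKron (F : ∀ i, Matrix (κ i) (κ i) ℂ) : Matrix (∀ i, κ i) (∀ i, κ i) ℂ :=
  Matrix.of fun p q => ∏ i, F i (p i) (q i)

theorem piKron_mul [DecidableEq ι] [∀ i, Fintype (κ i)] (F G : ∀ i, Matrix (κ i) (κ i) ℂ) :
    piKron (fun i => F i * G i) = piKron F * piKron G := by
  ext p q
  simp only [piKron, Matrix.of_apply, Matrix.mul_apply, Fintype.prod_sum, Finset.prod_mul_distrib]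

theorem piKron_conjTranspose (F : ∀ i, Matrix (κ i) (κ i) ℂ) :
    (piKron F).conjTranspose = piKron fun i => (F i).conjTranspose := by
  ext p q
  simp [piKron]

theorem piKron_one [∀ i, DecidableEq (κ i)] [DecidableEq (∀ i, κ i)]:
    piKron (fun i => (1 : Matrix (κ i) (κ i) ℂ)) = 1 := by
  ext p q
  simp only [piKron, Matrix.of_apply, Matrix.one_apply, Finset.prod_ite_zero, Finset.prod_const_one,
    funext_iff, Finset.mem_univ, true_imp_iff]

theorem trace_piKron [DecidableEq ι] [∀ i, Fintype (κ i)] (F : ∀ i, Matrix (κ i) (κ i) ℂ) :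
    (piKron F).trace = ∏ i, (F i).trace := by
  simp only [piKron, Matrix.trace, Matrix.diag, Matrix.of_apply, Fintype.prod_sum]

theorem isDensity_piKron [DecidableEq ι] [∀ i, Fintype (κ i)] [∀ i, DecidableEq (κ i)]
    {F : ∀ i, Matrix (κ i) (κ i) ℂ} (hF : ∀ i, IsDensity (F i)) : IsDensity (piKron F) := by
  refine ⟨?_, by simp [trace_piKron, (hF _).2]⟩
  choose B hB using fun i => (hF i).1.exists_eq_conjTranspose_mul_self
  rw [show F = fun i => (B i).conjTranspose * B i from funext hB, piKron_mul,
    ← piKron_conjTranspose]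
  exact Matrix.posSemidef_conjTranspose_mul_self _

/-- The factors are switched on one at a time: each multiplies by some `F j ⊗ 1`, which is a
contraction by `norm_emb_le`. -/
theorem norm_piKron_le_one [DecidableEq ι] [∀ i, Fintype (κ i)] [∀ i, DecidableEq (κ i)]
    {F : ∀ i, Matrix (κ i) (κ i) ℂ} (hF : ∀ i, ‖F i‖ ≤ 1) : ‖piKron F‖ ≤ 1 := by
  classical
  have hone : ‖(1 : Matrix (∀ i, κ i) (∀ i, κ i) ℂ)‖ ≤ 1 := by
    by_cases h : Nonempty (∀ i, κ i)
    · simp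
    · rw [not_nonempty_iff] at h
      rw [Subsingleton.elim (1 : Matrix (∀ i, κ i) (∀ i, κ i) ℂ) 0]
      simp
  have key (s : Finset ι) : ‖piKron fun i => if i ∈ s then F i else 1‖ ≤ 1 := by
    induction s using Finset.induction_on with
    | empty => simpa [piKron_one] using hone
    | insert j s hj ih =>
      have h1 : (fun i => if i ∈ insert j s then F i else (1 : Matrix (κ i) (κ i) ℂ)) = fun i =>
          (Function.update (fun i => (1 : Matrix (κ i) (κ i) ℂ)) j (F j) i) *
            (if i ∈ s then F i else 1) := by
        funext i
        by_cases h : i = j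
        · subst h; simp [hj]
        · simp [h]
      have hbij : Function.Bijective fun a : ∀ i, κ i =>
          (a j, fun i : {i // i ≠ j} => a i) := (Equiv.piSplitAt j κ).bijective
      have h2 : piKron (Function.update (fun i => (1 : Matrix (κ i) (κ i) ℂ)) j (F j)) =
          emb (fun a : ∀ i, κ i => a j) (fun a (i : {i // i ≠ j}) => a i) (F j) := by
        ext p q
        simp only [piKron, emb, Matrix.of_apply, funext_iff, Subtype.forall]
        rw [← Finset.mul_prod_erase _ _ (Finset.mem_univ j), Function.update_self]
        have : ∀ i ∈ Finset.univ.erase j, Function.update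
            (fun i => (1 : Matrix (κ i) (κ i) ℂ)) j (F j) i (p i) (q i) =
              if p i = q i then 1 else 0 := by
          intro i hi
          rw [Function.update_of_ne (Finset.ne_of_mem_erase hi), Matrix.one_apply]
        rw [Finset.prod_congr rfl this, Finset.prod_ite_zero]
        simp
      rw [h1, piKron_mul, h2]
      refine (norm_mul_le _ _).trans ?_
      exact mul_le_one₀ ((norm_emb_le hbij _).trans (hF j)) (norm_nonneg _) ih
  simpa using key Finset.univ

end PiKron

/-! ### Density matrices: trace bound and unitary evolution -/

section States

variable {C : Type*} [Fintype C] [DecidableEq C]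

/-- With `ρ = Bᴴ B`, the trace is `∑ ⟪x i, O x i⟫` over the conjugated rows `x i` of `B`, and `∑ ‖x
i‖ ^ 2 = tr ρ = 1`. -/
theorem IsDensity.norm_trace_mul_le {ρ : Matrix C C ℂ} (hρ : IsDensity ρ) (O : Matrix C C ℂ) :
    ‖(O * ρ).trace‖ ≤ ‖O‖ := by
  obtain ⟨B, hB⟩ := hρ.1.exists_eq_conjTranspose_mul_self
  let x : C → EuclideanSpace ℂ C := fun i => WithLp.toLp 2 fun c => star (B i c)
  have h1 : (O * ρ).trace = ∑ i, inner ℂ (x i) (WithLp.toLp 2 (O.mulVec (x i).ofLp)) := by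
    rw [hB, ← mul_assoc, Matrix.trace_mul_comm, Matrix.trace]
    refine Finset.sum_congr rfl fun i _ => ?_
    rw [EuclideanSpace.inner_eq_star_dotProduct, dotProduct_comm]
    simp [x, Matrix.mul_apply, Matrix.mulVec, dotProduct]
  have h2 : ∑ i, ‖x i‖ ^ 2 = 1 := by
    have h3 : (B * B.conjTranspose).trace = 1 := by rw [Matrix.trace_mul_comm, ← hB, hρ.2]
    have h4 : ((∑ i, ‖x i‖ ^ 2 : ℝ) : ℂ) = 1 := by
      rw [← h3]
      simp [x, EuclideanSpace.norm_sq_eq, Matrix.trace, Matrix.mul_apply, Complex.mul_conj']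
    exact_mod_cast h4
  rw [h1]
  calc _ ≤ ∑ i, ‖O‖ * ‖x i‖ ^ 2 := by
        refine norm_sum_le_of_le _ fun i _ => ?_
        refine (norm_inner_le_norm _ _).trans ?_
        have := Matrix.l2_opNorm_mulVec O (x i)
        calc _ ≤ ‖x i‖ * (‖O‖ * ‖x i‖) := by gcongr; exact this
          _ = _ := by ring
    _ = ‖O‖ := by rw [← Finset.mul_sum, h2, mul_one]

theorem IsDensity.conj_exp {ρ H : Matrix C C ℂ} (hρ : IsDensity ρ) (hH : H.IsHermitian) (t : ℝ) :
    IsDensity (NormedSpace.exp ((-(Complex.I * (t : ℂ))) • H) * ρ *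
      NormedSpace.exp ((Complex.I * (t : ℂ)) • H)) := by
  let _ : NormedAlgebra ℚ (Matrix C C ℂ) := NormedAlgebra.restrictScalars ℚ ℂ _
  have h1 : NormedSpace.exp ((Complex.I * (t : ℂ)) • H) =
      (NormedSpace.exp ((-(Complex.I * (t : ℂ))) • H)).conjTranspose := by
    rw [← Matrix.exp_conjTranspose, Matrix.conjTranspose_smul, hH.eq]
    simp
  have h2 : NormedSpace.exp ((Complex.I * (t : ℂ)) • H) *
      NormedSpace.exp ((-(Complex.I * (t : ℂ))) • H) = 1 := by
    rw [← NormedSpace.exp_add_of_commute (((Commute.refl H).smul_left _).smul_right _), ← add_smul]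
    simp
  constructor
  · rw [h1]
    exact hρ.1.mul_mul_conjTranspose_same _
  · rw [Matrix.trace_mul_comm, ← mul_assoc, h2, one_mul, hρ.2]

end States

/-! ### Supports of lattice operators -/

section Support

variable {Ω : Type*} {d : Ω → ℕ}

/-- The restriction of a configuration to the sites satisfying `p`. -/
def res (p : Ω → Prop) (a : Config d) : ∀ x : {x // p x}, Fin (d x) := fun x => a x

theorem res_eq_iff {p : Ω → Prop} {a b : Config d} : res p a = res p b ↔ ∀ x, p x → a x = b x := by
  simp [res, funext_iff]

theorem bijective_res {p q : Ω → Prop} (hpq : ∀ x, q x ↔ ¬ p x) :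
    Function.Bijective fun a : Config d => (res p a, res q a) := by
  classical
  obtain rfl : q = fun x => ¬ p x := funext fun x => propext (hpq x)
  exact (Equiv.piEquivPiSubtypeProd p fun x => Fin (d x)).bijective

/-- `A` acts on the sites satisfying `p` only. -/
def SupportedOn (p : Ω → Prop) (A : Matrix (Config d) (Config d) ℂ) : Prop :=
  ∃ B, A = emb (res p) (res fun x => ¬ p x) B

theorem IsSupportedIn.supportedOn {Z : Finset Ω} {A : Matrix (Config d) (Config d) ℂ}
    (h : IsSupportedIn Z A) : SupportedOn (· ∈ Z) A := by
  obtain ⟨B, hB⟩ := h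
  refine ⟨B, ?_⟩
  ext a b
  rw [hB]
  simp only [emb, Matrix.of_apply]
  exact ite_congr_of_iff res_eq_iff.symm _ _

theorem SupportedOn.exists_eq {p q : Ω → Prop} {A : Matrix (Config d) (Config d) ℂ}
    (h : SupportedOn p A) (hpq : ∀ x, q x ↔ ¬ p x) : ∃ B, A = emb (res p) (res q) B := by
  obtain rfl : q = fun x => ¬ p x := funext fun x => propext (hpq x)
  exact h

theorem SupportedOn.mono {p q : Ω → Prop} {A : Matrix (Config d) (Config d) ℂ}
    (h : SupportedOn p A) (hpq : ∀ x, p x → q x) : SupportedOn q A := by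
  classical
  obtain ⟨B, rfl⟩ := h
  refine ⟨Matrix.of fun u v => if ∀ x (hx : q x), ¬ p x → u ⟨x, hx⟩ = v ⟨x, hx⟩ then
    B (fun x => u ⟨x, hpq _ x.2⟩) (fun x => v ⟨x, hpq _ x.2⟩) else 0, ?_⟩
  ext a b
  simp only [emb, Matrix.of_apply, res_eq_iff]
  rw [← ite_and]
  refine ite_congr_of_iff ⟨fun h => ⟨fun x hx => h x (mt (hpq x) hx), fun x _ hx => h x hx⟩,
    fun h x hx => ?_⟩ _ _
  by_cases hq : q x
  · exact h.2 x hq hx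
  · exact h.1 x hq

theorem SupportedOn.add {p : Ω → Prop} {A A' : Matrix (Config d) (Config d) ℂ}
    (h : SupportedOn p A) (h' : SupportedOn p A') : SupportedOn p (A + A') := by
  obtain ⟨B, rfl⟩ := h
  obtain ⟨B', rfl⟩ := h'
  refine ⟨B + B', ?_⟩
  ext a b
  simp only [emb, Matrix.add_apply, Matrix.of_apply]
  split_ifs <;> simp

theorem SupportedOn.sum {p : Ω → Prop} {ι : Type*} {s : Finset ι}
    {A : ι → Matrix (Config d) (Config d) ℂ} (h : ∀ i ∈ s, SupportedOn p (A i)) :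
    SupportedOn p (∑ i ∈ s, A i) := by
  refine Finset.sum_induction A (SupportedOn p) (fun _ _ => SupportedOn.add) ⟨0, ?_⟩ h
  ext a b
  simp [emb]

theorem SupportedOn.commute [Fintype Ω] [DecidableEq Ω] {p q : Ω → Prop}
    {A A' : Matrix (Config d) (Config d) ℂ} (h : SupportedOn p A) (h' : SupportedOn q A')
    (hpq : ∀ x, q x → ¬ p x) : Commute A A' := by
  classical
  obtain ⟨B, rfl⟩ := h
  obtain ⟨B', rfl⟩ := (h'.mono hpq).exists_eq (q := p) (fun x => not_not.symm)
  exact emb_comm_emb (bijective_res fun x => Iff.rfl) B B'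

end Support

/-! ### Dynamics of two decoupled halves -/

section Decoupling

variable {C α β : Type*} {f : C → α} {g : C → β}

theorem isHermitian_of_emb [Nonempty β] (hfg : Function.Bijective fun a => (f a, g a))
    {M : Matrix α α ℂ} (hM : (emb f g M).IsHermitian) : M.IsHermitian := by
  ext x y
  obtain ⟨z⟩ := ‹Nonempty β›
  obtain ⟨a, ha⟩ := hfg.2 (x, z)
  obtain ⟨b, hb⟩ := hfg.2 (y, z)
  simp only [Prod.mk.injEq] at ha hb
  have := hM.apply a b
  simpa [emb, ha.1, ha.2, hb.1, hb.2] using this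

variable [Fintype C] [Fintype α] [Fintype β] [DecidableEq C] [DecidableEq α] [DecidableEq β]

/-- The two generators commute, so the exponential factors, and each factor passes through the
operators of the other half. -/
theorem exp_mul_emb_mul_emb_mul_exp (hfg : Function.Bijective fun a => (f a, g a))
    (h₀ r₀ : Matrix α α ℂ) (h₁ r₁ : Matrix β β ℂ) (z : ℂ) :
    NormedSpace.exp ((-z) • (emb f g h₀ + emb g f h₁)) * (emb f g r₀ * emb g f r₁) *
      NormedSpace.exp (z • (emb f g h₀ + emb g f h₁)) =
    emb f g (NormedSpace.exp ((-z) • h₀) * r₀ * NormedSpace.exp (z • h₀)) *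
      emb g f (NormedSpace.exp ((-z) • h₁) * r₁ * NormedSpace.exp (z • h₁)) := by
  have hgf : Function.Bijective fun a => (g a, f a) := (Equiv.prodComm α β).bijective.comp hfg
  let _ : NormedAlgebra ℚ (Matrix C C ℂ) := NormedAlgebra.restrictScalars ℚ ℂ _
  have hexp (w : ℂ) : NormedSpace.exp (w • (emb f g h₀ + emb g f h₁)) =
      emb f g (NormedSpace.exp (w • h₀)) * emb g f (NormedSpace.exp (w • h₁)) := by
    rw [smul_add, NormedSpace.exp_add_of_commute
      (((emb_comm_emb hfg h₀ h₁).smul_left w).smul_right w), emb_exp hfg, emb_exp hgf]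
    congr 2
    · exact (map_smul (embHom hfg) w h₀).symm
    · exact (map_smul (embHom hgf) w h₁).symm
  rw [hexp, hexp, emb_mul hfg, emb_mul hfg, emb_mul hgf, emb_mul hgf]
  have c (M : Matrix α α ℂ) (N : Matrix β β ℂ) := (emb_comm_emb hfg M N).eq
  simp only [mul_assoc]
  congr 1
  simp only [← mul_assoc]
  rw [← c]
  simp only [mul_assoc]
  congr 1
  rw [← mul_assoc (emb g f r₁), ← c]
  simp only [← mul_assoc]
  rw [← c]

/-- The evolution without interactions between the two halves of the lattice keeps a product state
a product state with respect to these halves. -/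
theorem evolve_productState_eq {Ω : Type*} [Fintype Ω] [DecidableEq Ω] {d : Ω → ℕ}
    {p q : Ω → Prop} [DecidablePred p] [DecidablePred q] (hpq : ∀ x, q x ↔ ¬ p x)
    {H₀ H₁ : Matrix (Config d) (Config d) ℂ}
    (hH₀ : H₀.IsHermitian) (hH₁ : H₁.IsHermitian) (hp : SupportedOn p H₀) (hq : SupportedOn q H₁)
    {ρ : ∀ x, Matrix (Fin (d x)) (Fin (d x)) ℂ} (hρ : ∀ x, IsDensity (ρ x)) (t : ℝ) :
    ∃ (r₀ : Matrix (∀ x : {x // p x}, Fin (d x)) (∀ x : {x // p x}, Fin (d x)) ℂ)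
      (r₁ : Matrix (∀ x : {x // q x}, Fin (d x)) (∀ x : {x // q x}, Fin (d x)) ℂ),
      IsDensity r₀ ∧ IsDensity r₁ ∧ ∀ a b, evolve (H₀ + H₁) t (productState ρ) a b =
        r₀ (res p a) (res p b) * r₁ (res q a) (res q b) := by
  -- Trace one excludes `d x = 0`; nonempty complementary factors are needed to read off hermiticity
  -- of `h₀` and `h₁`.
  have hne (x) : Nonempty (Fin (d x)) := by
    by_contra h
    rw [not_nonempty_iff] at h
    simpa [Matrix.trace] using (hρ x).2
  have hb := bijective_res (d := d) hpq
  have hb' : Function.Bijective fun a : Config d => (res q a, res p a) :=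
    bijective_res fun x => by rw [hpq, not_not]
  obtain ⟨h₀, rfl⟩ := hp.exists_eq hpq
  obtain ⟨h₁, rfl⟩ := hq.exists_eq (q := p) fun x => by rw [hpq, not_not]
  refine ⟨_, _, (isDensity_piKron fun x : {x // p x} => hρ x).conj_exp
    (isHermitian_of_emb hb hH₀) t, (isDensity_piKron fun x : {x // q x} => hρ x).conj_exp
    (isHermitian_of_emb hb' hH₁) t, fun a b => ?_⟩
  have hprod : productState ρ = emb (res p) (res q) (piKron fun x : {x // p x} => ρ x) *
      emb (res q) (res p) (piKron fun x : {x // q x} => ρ x) := by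
    ext a b
    rw [emb_mul_emb_apply hb]
    simp only [productState, piKron, Matrix.of_apply, res]
    rw [← Fintype.prod_subtype_mul_prod_subtype p fun x => ρ x (a x) (b x)]
    congr 1
    exact Fintype.prod_equiv (Equiv.subtypeEquivRight fun x => (hpq x).symm) _ _ fun _ => rfl
  rw [← emb_mul_emb_apply hb, ← exp_mul_emb_mul_emb_mul_exp hb, evolve, hprod]

/-- Passage to the Heisenberg picture, by cyclicity of the trace. -/
theorem trace_mul_evolve {Ω : Type*} [Fintype Ω] [DecidableEq Ω] {d : Ω → ℕ}
    (O H ρ : Matrix (Config d) (Config d) ℂ) (t : ℝ) :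
    (O * evolve H t ρ).trace = (flow (Complex.I • H) t O * ρ).trace := by
  have h (s : ℝ) : s • Complex.I • H = (Complex.I * (s : ℂ)) • H := by
    rw [mul_comm, mul_smul, Complex.coe_smul]
  rw [flow, h, h, evolve, ← mul_assoc, ← mul_assoc, Matrix.trace_mul_comm, Complex.ofReal_neg,
    mul_neg]
  simp only [mul_assoc]

end Decoupling

/-! ### Reduced states of the regions and correlators -/

section Regions

variable {Ω : Type} {d : Ω → ℕ} {n : ℕ} {X : Fin n → Finset Ω}

/-- The restriction of a configuration to the regions. -/
def resRegions (X : Fin n → Finset Ω) (a : Config d) : ∀ i, RegionConfig d X i := fun _ x => a x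

theorem bijective_resRegions (hX : ∀ i j, i ≠ j → Disjoint (X i) (X j)) :
    Function.Bijective fun a : Config d => (resRegions X a, res (fun x => ∀ i, x ∉ X i) a) := by
  classical
  constructor
  · intro a b h
    simp only [Prod.mk.injEq, res_eq_iff] at h
    funext x
    by_cases hx : ∀ i, x ∉ X i
    · exact h.2 x hx
    · push Not at hx
      obtain ⟨i, hi⟩ := hx
      exact congrFun (congrFun h.1 i) ⟨x, hi⟩
  · rintro ⟨u, v⟩
    refine ⟨fun x => if h : ∃ i, x ∈ X i then u h.choose ⟨x, h.choose_spec⟩ else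
      v ⟨x, not_exists.1 h⟩, ?_⟩
    ext1
    · funext i ⟨x, hx⟩
      have h : ∃ i, x ∈ X i := ⟨i, hx⟩
      simp only [resRegions, dif_pos h]
      have key : ∀ j (hj : x ∈ X j), u j ⟨x, hj⟩ = u i ⟨x, hx⟩ := by
        intro j hj
        obtain rfl : j = i := by
          by_contra hne
          exact Finset.disjoint_left.1 (hX j i hne) hj hx
        rfl
      exact key _ _
    · funext ⟨x, hx⟩
      have h : ¬ ∃ i, x ∈ X i := not_exists.2 hx
      simp [res, dif_neg h]

theorem supportedOn_emb_resRegions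
    (M : Matrix (∀ i, RegionConfig d X i) (∀ i, RegionConfig d X i) ℂ) :
    SupportedOn (fun x => ∃ i, x ∈ X i)
      (emb (resRegions X) (res fun x => ∀ i, x ∉ X i) M : Matrix (Config d) (Config d) ℂ) := by
  refine ⟨Matrix.of fun u v => M (fun i x => u ⟨x, i, x.2⟩) (fun i x => v ⟨x, i, x.2⟩), ?_⟩
  ext a b
  simp only [emb, Matrix.of_apply]
  refine ite_congr_of_iff ?_ _ _
  simp [res_eq_iff]

variable [Fintype Ω] [DecidableEq Ω]

theorem regionState_eq_ptrace (ρ : Matrix (Config d) (Config d) ℂ)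
    [∀ i, DecidableEq (RegionConfig d X i)] :
    regionState X ρ = ptrace (resRegions X) (res fun x => ∀ i, x ∉ X i) ρ := by
  ext p q
  simp only [regionState, ptrace, Matrix.of_apply]
  refine Finset.sum_congr rfl fun a _ => Finset.sum_congr rfl fun b _ => ?_
  refine ite_congr_of_iff (and_congr ?_ res_eq_iff.symm) _ _
  simp only [resRegions, funext_iff, ← forall_and]

/-- The correlator operator is a full tensor product, with the identity at the parties not in the
tuple. -/
theorem norm_correlatorOp_le_one {P : Fin n → Type} [∀ i, Fintype (P i)]
    [∀ i, DecidableEq (P i)] {m : Fin n → ℕ}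
    {E : ∀ i : Fin n, Fin (m i) → Matrix (P i) (P i) ℂ} (hE : IsObservableFamily P E) {s : ℕ}
    (I : Fin s ↪ Fin n) (k : ∀ j, Fin (m (I j))) : ‖correlatorOp P E I k‖ ≤ 1 := by
  classical
  let F : ∀ i, Matrix (P i) (P i) ℂ := fun i =>
    if h : ∃ j, I j = i then E i (h.choose_spec ▸ k h.choose) else 1
  have hone (i) : ‖(1 : Matrix (P i) (P i) ℂ)‖ ≤ 1 := by
    by_cases h : Nonempty (P i)
    · simp
    · rw [not_nonempty_iff] at h
      rw [Subsingleton.elim (1 : Matrix (P i) (P i) ℂ) 0]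
      simp
  have hF (i) : ‖F i‖ ≤ 1 := by
    simp only [F]
    split_ifs
    exacts [(hE _ _).2, hone i]
  have hFI (j) : F (I j) = E (I j) (k j) := by
    have h : ∃ j', I j' = I j := ⟨j, rfl⟩
    simp only [F, dif_pos h]
    have key : ∀ j' (h : I j' = I j), E (I j) (h ▸ k j') = E (I j) (k j) := by
      intro j' h
      obtain rfl := I.injective h
      rfl
    exact key _ _
  have hF1 (i) (h : ∀ j, I j ≠ i) : F i = 1 := dif_neg fun ⟨j, hj⟩ => h j hj
  have : correlatorOp P E I k = piKron F := by
    ext p q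
    simp only [correlatorOp, piKron, Matrix.of_apply]
    rw [← Finset.prod_mul_prod_compl (Finset.univ.map I), Finset.prod_map]
    have : ∀ i ∈ (Finset.univ.map I)ᶜ, F i (p i) (q i) = if p i = q i then 1 else 0 := by
      intro i hi
      rw [hF1 i (by simpa using hi), Matrix.one_apply]
    rw [Finset.prod_congr rfl this, Finset.prod_ite_zero]
    simp [hFI]
  rw [this]
  exact norm_piKron_le_one hF

/-- The state of the regions is a product over two blocks if the state of the lattice is. -/
theorem regionState_mem_biseparableStates {f : Fin n → Fin 2} (hf : Function.Surjective f)
    {c : Ω → Fin 2} (hc : ∀ i, ∀ x ∈ X i, c x = f i)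
    {r₀ : Matrix (∀ x : {x // c x = 0}, Fin (d x)) (∀ x : {x // c x = 0}, Fin (d x)) ℂ}
    {r₁ : Matrix (∀ x : {x // c x = 1}, Fin (d x)) (∀ x : {x // c x = 1}, Fin (d x)) ℂ}
    (h₀ : IsDensity r₀) (h₁ : IsDensity r₁) {ρ : Matrix (Config d) (Config d) ℂ}
    (hρ : ∀ a b, ρ a b = r₀ (res _ a) (res _ b) * r₁ (res _ a) (res _ b)) :
    regionState X ρ ∈ biseparableStates (RegionConfig d X) := by
  classical
  let r : ∀ b : Fin 2,
      Matrix (∀ x : {x // c x = b}, Fin (d x)) (∀ x : {x // c x = b}, Fin (d x)) ℂ :=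
    fun b => match b with
      | 0 => r₀
      | 1 => r₁
  let F : ∀ b : Fin 2,
      (∀ x : {x // c x = b}, Fin (d x)) → ∀ i : {i // f i = b}, RegionConfig d X i :=
    fun b u i x => u ⟨x, (hc i x x.2).trans i.2⟩
  let G : ∀ b : Fin 2, (∀ x : {x // c x = b}, Fin (d x)) →
      ∀ x : {x : {x // c x = b} // ∀ i, x.1 ∉ X i}, Fin (d x.1) := fun b u x => u x
  have hinj (b) : Function.Injective fun u => (F b u, G b u) := by
    intro u v h
    simp only [Prod.mk.injEq] at h
    funext x
    by_cases hx : ∀ i, x.1 ∉ X i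
    · exact congrFun h.2 ⟨x, hx⟩
    · push Not at hx
      obtain ⟨i, hi⟩ := hx
      exact congrFun (congrFun h.1 ⟨i, (hc i _ hi).symm.trans x.2⟩) ⟨x.1, hi⟩
  have hr : ∀ b, IsDensity (r b) := Fin.forall_fin_two.2 ⟨h₀, h₁⟩
  refine subset_convexHull ℝ _ ⟨2, le_rfl, f, hf, subset_convexHull ℝ _
    ⟨fun b => ptrace (F b) (G b) (r b), fun b => (hr b).ptrace (hinj b), ?_⟩⟩
  ext p q
  let pb : ∀ e : Fin 2, ∀ i : {i // f i = e}, RegionConfig d X i := fun _ i => p i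
  let qb : ∀ e : Fin 2, ∀ i : {i // f i = e}, RegionConfig d X i := fun _ i => q i
  have hb : Function.Bijective fun a : Config d =>
      (res (fun x => c x = 0) a, res (fun x => c x = 1) a) :=
    bijective_res fun x => by omega
  -- The partial trace constraint decouples into one constraint per colour, so the double sum
  -- factors like `ρ` itself.
  have hcond (a b : Config d) : ((∀ i, ∀ x : X i, a x = p i x ∧ b x = q i x) ∧
      (∀ x, (∀ i, x ∉ X i) → a x = b x)) ↔
      ∀ e : Fin 2, (F e (res _ a) = pb e ∧ F e (res _ b) = qb e) ∧
        G e (res _ a) = G e (res _ b) := by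
    simp only [F, G, pb, qb, res, funext_iff, Subtype.forall]
    constructor
    · exact fun h e => ⟨⟨fun i _ x hx => (h.1 i x hx).1, fun i _ x hx => (h.1 i x hx).2⟩,
        fun x _ hx => h.2 x hx⟩
    · exact fun h => ⟨fun i x hx => ⟨(h (f i)).1.1 i rfl x hx, (h (f i)).1.2 i rfl x hx⟩,
        fun x hx => (h (c x)).2 x rfl hx⟩
  simp only [regionState, blockProduct, ptrace, Matrix.of_apply, Fin.prod_univ_two,
    Finset.sum_mul_sum]
  change _ = ∑ u, ∑ v, ∑ u', ∑ v', (if (F 0 u = pb 0 ∧ F 0 u' = qb 0) ∧ G 0 u = G 0 u' then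
    r 0 u u' else 0) * (if (F 1 v = pb 1 ∧ F 1 v' = qb 1) ∧ G 1 v = G 1 v' then r 1 v v' else 0)
  simp only [hcond, Fin.forall_fin_two, hρ]
  rw [sum_bijective hb fun u v => ∑ b, if ((F 0 u = pb 0 ∧ F 0 (res _ b) = qb 0) ∧
      G 0 u = G 0 (res _ b)) ∧ (F 1 v = pb 1 ∧ F 1 (res _ b) = qb 1) ∧
      G 1 v = G 1 (res _ b) then r 0 u (res _ b) * r 1 v (res _ b) else 0]
  refine Finset.sum_congr rfl fun u _ => Finset.sum_congr rfl fun v _ => ?_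
  rw [sum_bijective hb fun u' v' => if ((F 0 u = pb 0 ∧ F 0 u' = qb 0) ∧
      G 0 u = G 0 u') ∧ (F 1 v = pb 1 ∧ F 1 v' = qb 1) ∧
      G 1 v = G 1 v' then r 0 u u' * r 1 v v' else 0]
  refine Finset.sum_congr rfl fun u' _ => Finset.sum_congr rfl fun v' _ => ?_
  rw [ite_zero_mul_ite_zero]

end Regions

/-! ### Layers around a region and the depth function -/

section Geometry

variable {Ω : Type*} [Fintype Ω] [MetricSpace Ω]

open Classical in
/-- The sites which are reached from `X` by at most `k` steps of length at most `R`. -/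
noncomputable def layer (R : ℝ) (X : Finset Ω) : ℕ → Finset Ω
  | 0 => X
  | k + 1 => Finset.univ.filter fun x => x ∈ layer R X k ∨ ∃ y ∈ layer R X k, dist y x ≤ R

variable {R : ℝ} {X : Finset Ω}

theorem mem_layer_succ {k : ℕ} {x : Ω} :
    x ∈ layer R X (k + 1) ↔ x ∈ layer R X k ∨ ∃ y ∈ layer R X k, dist y x ≤ R := by
  simp [layer]

theorem layer_mono : Monotone (layer R X) :=
  monotone_nat_of_le_succ fun _ _ hx => mem_layer_succ.2 (Or.inl hx)

theorem mem_layer_succ_of_dist_le {k : ℕ} {x y : Ω} (hy : y ∈ layer R X k) (h : dist y x ≤ R) :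
    x ∈ layer R X (k + 1) := mem_layer_succ.2 (Or.inr ⟨y, hy, h⟩)

theorem exists_dist_le_of_mem_layer {R' : ℝ} (hR : R ≤ R') (hR' : 0 ≤ R') {k : ℕ} {x : Ω}
    (hx : x ∈ layer R X k) : ∃ y ∈ X, dist y x ≤ k * R' := by
  induction k generalizing x with
  | zero => exact ⟨x, hx, by simp⟩
  | succ k ih =>
    obtain hx | ⟨z, hz, hzx⟩ := mem_layer_succ.1 hx
    · obtain ⟨y, hy, h⟩ := ih hx
      refine ⟨y, hy, h.trans ?_⟩
      push_cast
      nlinarith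
    · obtain ⟨y, hy, h⟩ := ih hz
      refine ⟨y, hy, (dist_triangle y z x).trans ?_⟩
      push_cast
      nlinarith

variable {N : ℕ}

/-- Each step keeps the old sites and adds at most `N` per site; keeping them separately avoids
assuming `0 ≤ R`. -/
theorem card_layer_le (hN : ∀ x : Ω, (Metric.closedBall x R).ncard ≤ N) (k : ℕ) :
    (layer R X k).card ≤ X.card * (N + 1) ^ k := by
  classical
  induction k with
  | zero => simp [layer]
  | succ k ih =>
    have hsub : layer R X (k + 1) ⊆ layer R X k ∪
        (layer R X k).biUnion fun y => (Metric.closedBall y R).toFinset := by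
      intro x hx
      obtain hx | ⟨z, hz, hzx⟩ := mem_layer_succ.1 hx
      · exact Finset.mem_union_left _ hx
      · exact Finset.mem_union_right _ (Finset.mem_biUnion.2 ⟨z, hz, by
          simpa [dist_comm] using hzx⟩)
    have hb : ((layer R X k).biUnion fun y => (Metric.closedBall y R).toFinset).card ≤
        (layer R X k).card * N :=
      Finset.card_biUnion_le_card_mul _ _ _ fun y _ => by
        rw [← Set.ncard_eq_toFinset_card']; exact hN y
    calc _ ≤ (layer R X k).card + (layer R X k).card * N :=
          (Finset.card_le_card hsub).trans ((Finset.card_union_le _ _).trans (by gcongr))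
      _ = (layer R X k).card * (N + 1) := by ring
      _ ≤ X.card * (N + 1) ^ k * (N + 1) := by gcongr
      _ = _ := by ring

open Classical in
/-- The number of steps from `x` to the complement of the shell between `X` and the complement of
the `2 r - 1`st layer. -/
noncomputable def depth (R : ℝ) (X : Finset Ω) (r : ℕ) (x : Ω) : ℕ :=
  ((Finset.range r).filter fun k => x ∈ layer R X (2 * r - 1 - k) ∧ x ∉ layer R X k).card

/-- An index `k + 1` counted for `x` forces `k` to be counted for `y`, since one step moves by at
most one layer; only `k = 0` is lost. -/
theorem depth_le_depth_add_one (r : ℕ) {x y : Ω} (h : dist x y ≤ R) :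
    depth R X r x ≤ depth R X r y + 1 := by
  classical
  set S := (Finset.range r).filter fun k => y ∈ layer R X (2 * r - 1 - k) ∧ y ∉ layer R X k with hS
  have hsub : ((Finset.range r).filter fun k => x ∈ layer R X (2 * r - 1 - k) ∧ x ∉ layer R X k) ⊆
      insert 0 (S.image Nat.succ) := by
    intro k hk
    simp only [Finset.mem_filter, Finset.mem_range] at hk
    obtain ⟨hk, h1, h2⟩ := hk
    cases k with
    | zero => simp
    | succ k =>
      refine Finset.mem_insert_of_mem (Finset.mem_image.2 ⟨k, ?_, rfl⟩)
      simp only [hS, Finset.mem_filter, Finset.mem_range]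
      refine ⟨by omega, ?_, fun hy => h2 (mem_layer_succ_of_dist_le hy (by rwa [dist_comm]))⟩
      have := mem_layer_succ_of_dist_le h1 h
      rwa [show 2 * r - 1 - (k + 1) + 1 = 2 * r - 1 - k by omega] at this
  calc _ ≤ _ := Finset.card_le_card hsub
    _ ≤ _ := Finset.card_insert_le _ _
    _ ≤ _ := by
      gcongr
      exact Finset.card_image_le

theorem depth_eq_zero (r : ℕ) {x : Ω} (h : x ∈ X ∨ x ∉ layer R X (2 * r - 1)) :
    depth R X r x = 0 := by
  classical
  rw [depth, Finset.card_eq_zero, Finset.filter_eq_empty_iff]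
  rintro k - ⟨h1, h2⟩
  obtain h | h := h
  · exact h2 (layer_mono (Nat.zero_le k) h)
  · exact h (layer_mono (Nat.sub_le _ _) h1)

/-- Sites next to the cut sit in the middle of the shell: every `k < r - 1` is counted, as then `r +
1 ≤ 2 * r - 1 - k`. -/
theorem le_depth {r : ℕ} {x : Ω} (h : x ∈ layer R X (r + 1)) (h' : 0 < r → x ∉ layer R X (r - 1)) :
    r - 1 ≤ depth R X r x := by
  classical
  calc r - 1 = (Finset.range (r - 1)).card := (Finset.card_range _).symm
    _ ≤ _ := Finset.card_le_card fun k hk => ?_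
  simp only [Finset.mem_filter, Finset.mem_range] at hk ⊢
  exact ⟨by omega, layer_mono (by omega) h, fun hx => h' (by omega) (layer_mono (by omega) hx)⟩

end Geometry

/-! ### Splitting the Hamiltonian along a set of sites -/

section Hamiltonian

theorem I_smul_mem_skewAdjoint {C : Type*} [Fintype C] [DecidableEq C] {A : Matrix C C ℂ}
    (hA : A.IsHermitian) :
    Complex.I • A ∈ skewAdjoint (Matrix C C ℂ) := by
  rw [skewAdjoint.mem_iff, star_smul, Matrix.star_eq_conjTranspose, hA.eq]
  simp

theorem isHermitian_sum {C ι : Type*} {s : Finset ι} {A : ι → Matrix C C ℂ}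
    (hA : ∀ i, (A i).IsHermitian) : (∑ i ∈ s, A i).IsHermitian :=
  Finset.sum_induction A Matrix.IsHermitian (fun _ _ => Matrix.IsHermitian.add)
    Matrix.isHermitian_zero fun i _ => hA i

variable {Ω : Type*} [Fintype Ω] [DecidableEq Ω] {d : Ω → ℕ}

/-- The part of the Hamiltonian which acts on the sites of `L` only. -/
noncomputable def innerPart (h : Finset Ω → Matrix (Config d) (Config d) ℂ) (L : Finset Ω) :
    Matrix (Config d) (Config d) ℂ := ∑ Z with Z ⊆ L, h Z

/-- The part of the Hamiltonian which acts on the sites outside `L` only. -/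
noncomputable def outerPart (h : Finset Ω → Matrix (Config d) (Config d) ℂ) (L : Finset Ω) :
    Matrix (Config d) (Config d) ℂ := ∑ Z with ¬ Z ⊆ L ∧ ¬ ∃ x ∈ Z, x ∈ L, h Z

theorem hamiltonian_eq (h : Finset Ω → Matrix (Config d) (Config d) ℂ) (L : Finset Ω) :
    hamiltonian h = innerPart h L + outerPart h L + ∑ Z with ¬ Z ⊆ L ∧ ∃ x ∈ Z, x ∈ L, h Z := by
  rw [hamiltonian, innerPart, outerPart, ← Finset.sum_filter_add_sum_filter_not _ (· ⊆ L),
    add_assoc]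
  congr 1
  rw [← Finset.sum_filter_add_sum_filter_not _ (fun Z => ∃ x ∈ Z, x ∈ L), add_comm,
    Finset.filter_filter, Finset.filter_filter]

end Hamiltonian

/-! ### Locality estimates for finite-range interactions -/

section Interaction

variable {Ω : Type*} [Fintype Ω] [DecidableEq Ω] [MetricSpace Ω] {d : Ω → ℕ} {R J : ℝ} {N : ℕ}
  {h : Finset Ω → Matrix (Config d) (Config d) ℂ}

theorem IsInteraction.dist_le (hh : IsInteraction R J h) {Z : Finset Ω} (hZ : h Z ≠ 0) {x y : Ω}
    (hx : x ∈ Z) (hy : y ∈ Z) : dist x y ≤ R := by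
  by_contra hlt
  exact hZ (hh.range Z ⟨x, hx, y, hy, not_le.1 hlt⟩)

-- A nonzero term containing `y` is indexed by a subset of the `R`-ball around `y`, which leaves at
-- most `2 ^ N` choices.
open Classical in
theorem IsInteraction.card_terms_le (hh : IsInteraction R J h)
    (hN : ∀ x : Ω, (Metric.closedBall x R).ncard ≤ N) (Y : Finset Ω) :
    (Finset.univ.filter fun Z => (∃ x ∈ Z, x ∈ Y) ∧ h Z ≠ 0).card ≤ Y.card * 2 ^ N := by
  have hsub : (Finset.univ.filter fun Z => (∃ x ∈ Z, x ∈ Y) ∧ h Z ≠ 0) ⊆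
      Y.biUnion fun y => (Metric.closedBall y R).toFinset.powerset := by
    intro Z hZ
    obtain ⟨-, ⟨x, hxZ, hxY⟩, hZ0⟩ := Finset.mem_filter.1 hZ
    refine Finset.mem_biUnion.2 ⟨x, hxY, Finset.mem_powerset.2 fun z hz => ?_⟩
    simpa using hh.dist_le hZ0 hz hxZ
  refine (Finset.card_le_card hsub).trans (Finset.card_biUnion_le_card_mul _ _ _ fun y _ => ?_)
  rw [Finset.card_powerset, ← Set.ncard_eq_toFinset_card']
  exact Nat.pow_le_pow_right (by norm_num) (hN y)

theorem IsInteraction.card_le (hh : IsInteraction R J h)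
    (hN : ∀ x : Ω, (Metric.closedBall x R).ncard ≤ N) {Z : Finset Ω} (hZ : h Z ≠ 0) :
    Z.card ≤ N := by
  obtain rfl | ⟨x, hx⟩ := Z.eq_empty_or_nonempty
  · simp
  · rw [← Set.ncard_coe_finset]
    exact (Set.ncard_le_ncard (fun z hz => hh.dist_le hZ hz hx) (Set.toFinite _)).trans (hN x)

/-- The abstract bound is applied to the backward evolution of the terms, with the least value of
`D` on `Z` as the distance from `Z` to the support of `O`. -/
theorem IsInteraction.norm_commutator_flow_le (hh : IsInteraction R J h)
    (hN : ∀ x : Ω, (Metric.closedBall x R).ncard ≤ N) {w : Ω → Prop}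
    {O : Matrix (Config d) (Config d) ℂ} (hO : SupportedOn w O) (hO1 : ‖O‖ ≤ 1)
    {D : Ω → ℕ} (hD : ∀ x y, dist x y ≤ R → D x ≤ D y + 1) (hD0 : ∀ x, w x → D x = 0)
    {b : ℝ} (hb : 1 ≤ b) {t : ℝ} (ht : 0 ≤ t) {Z : Finset Ω} (hZ : Z.Nonempty) {k : ℕ}
    (hk : ∀ x ∈ Z, k ≤ D x) :
    ‖(Complex.I • h Z) * flow (Complex.I • hamiltonian h) t O -
        flow (Complex.I • hamiltonian h) t O * (Complex.I • h Z)‖ ≤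
      2 * J * (b ^ k)⁻¹ * Real.exp (4 * J * (N * 2 ^ N + 1) * b * t) := by
  classical
  set G := Complex.I • hamiltonian h with hG
  have hHs : G ∈ skewAdjoint (Matrix (Config d) (Config d) ℂ) :=
    I_smul_mem_skewAdjoint (isHermitian_sum hh.hermitian)
  have hJ : 0 ≤ J := (norm_nonneg _).trans (hh.strength Z)
  let g : Finset Ω → Matrix (Config d) (Config d) ℂ := fun Z => -(Complex.I • h Z)
  have hg0 (Z) : g Z ≠ 0 ↔ h Z ≠ 0 := by simp [g]
  have hgsum : ∑ Z, g Z = -G := by simp [g, hG, hamiltonian, Finset.smul_sum]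
  -- For `Z = ∅` this is `0`, which is harmless: the empty set meets no other set.
  let DD : Finset Ω → ℕ := fun Z => sInf (D '' (Z : Set Ω))
  have hDDle (Z : Finset Ω) (x) (hx : x ∈ Z) : DD Z ≤ D x := Nat.sInf_le ⟨x, hx, rfl⟩
  have hDDmem (Z : Finset Ω) (hZ : Z.Nonempty) : ∃ x ∈ Z, D x = DD Z :=
    Nat.sInf_mem (s := D '' (Z : Set Ω)) ((Finset.coe_nonempty.2 hZ).image D)
  have key := SpinBell.norm_commutator_flow_le g (fun Z W => ∃ x ∈ W, x ∈ Z)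
    (fun Z => neg_mem (I_smul_mem_skewAdjoint (hh.hermitian Z))) (J := J)
    (fun Z => by simpa [g, norm_smul] using hh.strength Z)
    (fun Z W hZW => by
      have : Commute (h W) (h Z) := (hh.supported W).supportedOn.commute
        (hh.supported Z).supportedOn fun x hx hxW => hZW ⟨x, hxW, hx⟩
      exact (((this.smul_left _).smul_right _).neg_left.neg_right).eq)
    -- The extra `1` keeps the velocity positive when `N = 0`, as the division in Duhamel's bound
    -- requires.
    (K := N * 2 ^ N + 1)
    (fun Z hZ => by
      have h1 := hh.card_terms_le hN Z
      have h2 := hh.card_le hN ((hg0 Z).1 hZ)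
      rw [Set.ncard_eq_toFinset_card', Set.toFinset_ofPred]
      simp only [hg0]
      calc _ ≤ Z.card * 2 ^ N := h1
        _ ≤ N * 2 ^ N := by gcongr
        _ ≤ _ := Nat.le_succ _)
    DD
    (fun Z W hZ hW ⟨x, hxW, hxZ⟩ => by
      obtain ⟨y, hy, hyD⟩ := hDDmem W ⟨x, hxW⟩
      calc DD Z ≤ D x := hDDle Z x hxZ
        _ ≤ D y + 1 := hD x y (hh.dist_le ((hg0 W).1 hW) hxW hy)
        _ = _ := by rw [hyD])
    O
    (fun Z hZ => by
      have : Commute (h Z) O := by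
        refine (hh.supported Z).supportedOn.commute hO fun x hx hxZ => hZ ?_
        have := hDDle Z x hxZ
        rw [hD0 x hx] at this
        omega
      exact ((this.smul_left _).neg_left).eq)
    hb ht Z
  rw [hgsum, flow_neg_generator] at key
  -- Isometric conjugation moves the evolution from `O` to the local term, with time reversed.
  have hflow : (Complex.I • h Z) * flow G t O - flow G t O * (Complex.I • h Z) =
      -flow G t (flow G (-t) (g Z) * O - O * flow G (-t) (g Z)) := by
    rw [flow_sub, flow_mul, flow_mul, flow_flow_neg]
    simp only [g]
    noncomm_ring
  rw [hflow, norm_neg, norm_flow hHs]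
  obtain ⟨y, hy, hyD⟩ := hDDmem Z hZ
  have hb0 : 0 < b := by linarith
  refine key.trans ?_
  push_cast
  have h1 : (b ^ DD Z)⁻¹ ≤ (b ^ k)⁻¹ := by
    gcongr
    rw [← hyD]
    exact hk y hy
  have h2 : 2 * J * ‖O‖ ≤ 2 * J := mul_le_of_le_one_right (by positivity) hO1
  gcongr

/-- Cutting the interactions across the boundary of the `r`th layer around `X` hardly changes the
evolution of an observable which acts on `X` and on far away sites. -/
theorem IsInteraction.norm_flow_sub_flow_le (hh : IsInteraction R J h) (hJ : 0 < J)
    (hN : ∀ x : Ω, (Metric.closedBall x R).ncard ≤ N) {X : Finset Ω} {r : ℕ} {w : Ω → Prop}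
    (hw : ∀ x, w x → x ∈ X ∨ x ∉ layer R X (2 * r - 1))
    {O : Matrix (Config d) (Config d) ℂ} (hO : SupportedOn w O) (hO1 : ‖O‖ ≤ 1)
    {b : ℝ} (hb : 1 ≤ b) {t : ℝ} (ht : 0 ≤ t) :
    ‖flow (Complex.I • hamiltonian h) t O -
        flow (Complex.I • (innerPart h (layer R X r) + outerPart h (layer R X r))) t O‖ ≤
      (X.card * (N + 1) ^ r * 2 ^ N) * (2 * J * (b ^ (r - 1))⁻¹) / (4 * J * (N * 2 ^ N + 1) * b) *
        (Real.exp (4 * J * (N * 2 ^ N + 1) * b * t) - 1) := by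
  classical
  have hb0 : 0 < b := by linarith
  set L := layer R X r with hL
  set G := Complex.I • hamiltonian h with hG
  have hin : (innerPart h L).IsHermitian := isHermitian_sum hh.hermitian
  have hout : (outerPart h L).IsHermitian := isHermitian_sum hh.hermitian
  have hG' := I_smul_mem_skewAdjoint (hin.add hout)
  refine SpinBell.norm_flow_sub_flow_le hG' O (by positivity) (fun s hs => ?_) ht
  set T : Finset (Finset Ω) := Finset.univ.filter fun Z => (¬ Z ⊆ L ∧ ∃ x ∈ Z, x ∈ L) ∧ h Z ≠ 0
    with hT
  have hdiff : G - Complex.I • (innerPart h L + outerPart h L) = ∑ Z ∈ T, Complex.I • h Z := by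
    rw [hG, hamiltonian_eq h L, ← smul_sub, add_sub_cancel_left, Finset.smul_sum, hT,
      ← Finset.filter_filter (fun Z => ¬ Z ⊆ L ∧ ∃ x ∈ Z, x ∈ L) (fun Z => h Z ≠ 0)]
    refine (Finset.sum_filter_of_ne ?_).symm
    intro Z _ hZ h0
    exact hZ (by rw [h0, smul_zero])
  have hTcard : (T.card : ℝ) ≤ X.card * (N + 1) ^ r * 2 ^ N := by
    have h1 : T.card ≤ L.card * 2 ^ N :=
      (Finset.card_le_card fun Z hZ => by
        simp only [hT, Finset.mem_filter] at hZ ⊢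
        exact ⟨hZ.1, hZ.2.1.2, hZ.2.2⟩).trans (hh.card_terms_le hN L)
    have h2 : L.card ≤ X.card * (N + 1) ^ r := card_layer_le hN r
    exact_mod_cast h1.trans (Nat.mul_le_mul_right _ h2)
  rw [hdiff, Finset.sum_mul, Finset.mul_sum, ← Finset.sum_sub_distrib]
  calc _ ≤ ∑ Z ∈ T, 2 * J * (b ^ (r - 1))⁻¹ * Real.exp (4 * J * (N * 2 ^ N + 1) * b * s) := by
        refine norm_sum_le_of_le _ fun Z hZ => ?_
        simp only [hT, Finset.mem_filter, Finset.mem_univ, true_and] at hZ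
        obtain ⟨⟨hZL, x, hxZ, hxL⟩, hZ0⟩ := hZ
        obtain ⟨y, hyZ, hyL⟩ := Finset.not_subset.1 hZL
        refine hh.norm_commutator_flow_le hN hO hO1 (D := depth R X r)
          (fun x y hxy => depth_le_depth_add_one r hxy) (fun x hx => depth_eq_zero r (hw x hx))
          hb hs ⟨x, hxZ⟩ fun z hz => le_depth ?_ ?_
        · exact mem_layer_succ_of_dist_le hxL (hh.dist_le hZ0 hxZ hz)
        · intro hr hz'
          have := mem_layer_succ_of_dist_le hz' (hh.dist_le hZ0 hz hyZ)
          rw [show r - 1 + 1 = r by omega] at this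
          exact hyL this
    _ = T.card * (2 * J * (b ^ (r - 1))⁻¹ * Real.exp (4 * J * (N * 2 ^ N + 1) * b * s)) := by
        rw [Finset.sum_const, nsmul_eq_mul]
    _ ≤ (X.card * (N + 1) ^ r * 2 ^ N) *
          (2 * J * (b ^ (r - 1))⁻¹ * Real.exp (4 * J * (N * 2 ^ N + 1) * b * s)) := by gcongr
    _ = _ := by ring

end Interaction

section Main

theorem minRegionDist_le {Ω : Type*} [MetricSpace Ω] {n : ℕ} {X : Fin n → Finset Ω}
    {i j : Fin n} (hij : i ≠ j) {x y : Ω} (hx : x ∈ X i) (hy : y ∈ X j) :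
    minRegionDist X ≤ dist x y := by
  have h0 (Y Y' : Finset Ω) : 0 ≤ regionDist Y Y' := by
    refine Real.sInf_nonneg ?_
    rintro r ⟨x, -, y, -, rfl⟩
    exact dist_nonneg
  calc minRegionDist X ≤ regionDist (X i) (X j) := csInf_le ⟨0, by
          rintro r ⟨i, j, -, rfl⟩
          exact h0 _ _⟩ ⟨i, j, hij, rfl⟩
    _ ≤ dist x y := csInf_le ⟨0, by
          rintro r ⟨x, -, y, -, rfl⟩
          exact dist_nonneg⟩ ⟨x, hx, y, hy, rfl⟩

theorem minRegionDist_nonneg {Ω : Type*} [MetricSpace Ω] {n : ℕ} (X : Fin n → Finset Ω) :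
    0 ≤ minRegionDist X := by
  refine Real.sInf_nonneg ?_
  rintro r ⟨i, j, -, rfl⟩
  refine Real.sInf_nonneg ?_
  rintro r ⟨x, -, y, -, rfl⟩
  exact dist_nonneg

/-- The state of the regions is close, on all correlators, to a biseparable state. -/
theorem exists_biseparable_correlator_sub_le {N : ℕ} {R R' J : ℝ} (hJ : 0 < J) (hR : R ≤ R')
    (hR' : 0 < R') {Ω : Type} [Fintype Ω] [DecidableEq Ω] [MetricSpace Ω]
    (hN : ∀ x : Ω, (Metric.closedBall x R).ncard ≤ N) {d : Ω → ℕ}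
    {h : Finset Ω → Matrix (Config d) (Config d) ℂ} (hh : IsInteraction R J h)
    {ρ : ∀ x, Matrix (Fin (d x)) (Fin (d x)) ℂ} (hρ : ∀ x, IsDensity (ρ x)) {t : ℝ} (ht : 0 ≤ t)
    {n : ℕ} (hn : 2 ≤ n) {X : Fin n → Finset Ω}
    (hX : ∀ i j, i ≠ j → Disjoint (X i) (X j)) (i₀ : Fin n) (r : ℕ)
    (hr : 2 * r * R' ≤ minRegionDist X) {b : ℝ} (hb : 1 ≤ b) :
    ∃ σ ∈ biseparableStates (RegionConfig d X), ∀ (m : Fin n → ℕ)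
      (E : ∀ i : Fin n, Fin (m i) → Matrix (RegionConfig d X i) (RegionConfig d X i) ℂ),
      IsObservableFamily (RegionConfig d X) E → ∀ (s : ℕ) (I : Fin s ↪ Fin n) (k),
      |correlator (RegionConfig d X) E
          (regionState X (evolve (hamiltonian h) t (productState ρ))) I k -
        correlator (RegionConfig d X) E σ I k| ≤
      ((X i₀).card * (N + 1) ^ r * 2 ^ N) * (2 * J * (b ^ (r - 1))⁻¹) /
        (4 * J * (N * 2 ^ N + 1) * b) * (Real.exp (4 * J * (N * 2 ^ N + 1) * b * t) - 1) := by
  classical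
  set L := layer R (X i₀) r with hL
  have hfar : ∀ i ≠ i₀, ∀ x ∈ X i, x ∉ layer R (X i₀) (2 * r - 1) ∧ x ∉ L := by
    intro i hi x hx
    have hX0 : x ∉ X i₀ := Finset.disjoint_left.1 (hX i i₀ hi) hx
    have hlayer : 0 < r → x ∉ layer R (X i₀) (2 * r - 1) := by
      intro hr0 hxl
      obtain ⟨y, hy, hyx⟩ := exists_dist_le_of_mem_layer hR hR'.le hxl
      have h1 := minRegionDist_le hi hx hy
      rw [dist_comm] at h1
      have h2 : ((2 * r - 1 : ℕ) : ℝ) = 2 * r - 1 := by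
        rw [Nat.cast_sub (by omega)]; push_cast; ring
      rw [h2] at hyx
      nlinarith
    rcases Nat.eq_zero_or_pos r with rfl | hr0
    · exact ⟨hX0, hX0⟩
    · exact ⟨hlayer hr0, fun hxL => hlayer hr0 (layer_mono (by omega) hxL)⟩
  let f : Fin n → Fin 2 := fun i => if i = i₀ then 0 else 1
  let c : Ω → Fin 2 := fun x => if x ∈ L then 0 else 1
  have hc0 (x) : c x = 0 ↔ x ∈ L := by simp [c]
  have hc1 (x) : c x = 1 ↔ x ∉ L := by simp [c]
  have hf : Function.Surjective f := by
    have : Nontrivial (Fin n) := Fin.nontrivial_iff_two_le.2 hn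
    obtain ⟨i₁, hi₁⟩ := exists_ne i₀
    exact Fin.forall_fin_two.2 ⟨⟨i₀, by simp [f]⟩, ⟨i₁, by simp [f, hi₁]⟩⟩
  have hcf : ∀ i, ∀ x ∈ X i, c x = f i := by
    intro i x hx
    by_cases hi : i = i₀
    · subst hi
      have : x ∈ L := layer_mono (Nat.zero_le r) hx
      simp [c, f, this]
    · simp [c, f, hi, (hfar i hi x hx).2]
  obtain ⟨r₀, r₁, h₀, h₁, hev⟩ := evolve_productState_eq (p := fun x => c x = 0)
    (q := fun x => c x = 1) (fun x => by omega) (H₀ := innerPart h L) (H₁ := outerPart h L)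
    (isHermitian_sum hh.hermitian) (isHermitian_sum hh.hermitian)
    (SupportedOn.sum fun Z hZ => (hh.supported Z).supportedOn.mono fun x hx =>
      (hc0 x).2 ((Finset.mem_filter.1 hZ).2 hx))
    (SupportedOn.sum fun Z hZ => (hh.supported Z).supportedOn.mono fun x hx =>
      (hc1 x).2 fun hxL => (Finset.mem_filter.1 hZ).2.2 ⟨x, hx, hxL⟩) hρ t
  refine ⟨_, regionState_mem_biseparableStates hf hcf h₀ h₁ hev, fun m E hE s I k => ?_⟩
  set O : Matrix (Config d) (Config d) ℂ := emb (resRegions X) (res fun x => ∀ i, x ∉ X i)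
    (correlatorOp (RegionConfig d X) E I k) with hO
  have hO1 : ‖O‖ ≤ 1 :=
    (norm_emb_le (bijective_resRegions hX) _).trans (norm_correlatorOp_le_one hE I k)
  have htr (ρ' : Matrix (Config d) (Config d) ℂ) :
      correlator (RegionConfig d X) E (regionState X ρ') I k = (O * ρ').trace.re := by
    rw [correlator, regionState_eq_ptrace, trace_mul_ptrace]
  rw [htr, htr, trace_mul_evolve, trace_mul_evolve, ← Complex.sub_re, ← Matrix.trace_sub,
    ← sub_mul]
  refine (Complex.abs_re_le_norm _).trans
    (((isDensity_piKron hρ).norm_trace_mul_le _).trans ?_)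
  refine hh.norm_flow_sub_flow_le hJ hN (w := fun x => ∃ i, x ∈ X i) ?_
    (supportedOn_emb_resRegions _) hO1 hb ht
  rintro x ⟨i, hx⟩
  by_cases hi : i = i₀
  · exact Or.inl (hi ▸ hx)
  · exact Or.inr (hfar i hi x hx).1

theorem pow_floor_mul_inv_pow_le (N : ℕ) (τ R' : ℝ) :
    ((N : ℝ) + 1) ^ ⌊τ / (2 * R')⌋₊ * (((N + 1) * Real.exp 1) ^ (⌊τ / (2 * R')⌋₊ - 1))⁻¹ ≤
      (N + 1) * Real.exp 2 * Real.exp (-(1 / (2 * R')) * τ) := by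
  set r := ⌊τ / (2 * R')⌋₊ with hr
  have h1 : τ / (2 * R') < r + 1 := Nat.lt_floor_add_one _
  have h2 : -(1 / (2 * R')) * τ = -(τ / (2 * R')) := by ring
  rw [h2, mul_assoc, ← Real.exp_add]
  rcases Nat.eq_zero_or_pos r with h0 | h0
  · rw [h0] at h1 ⊢
    simp only [pow_zero, Nat.zero_sub, inv_one, mul_one]
    have : 1 ≤ Real.exp (2 + -(τ / (2 * R'))) := Real.one_le_exp (by push_cast at h1; linarith)
    have hN : (1 : ℝ) ≤ N + 1 := by linarith [(Nat.cast_nonneg N : (0 : ℝ) ≤ N)]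
    nlinarith
  · obtain ⟨s, hs⟩ : ∃ s, r = s + 1 := ⟨r - 1, by omega⟩
    rw [hs] at h1 ⊢
    rw [Nat.add_sub_cancel, mul_pow, pow_succ, ← Real.exp_nat_mul, mul_one]
    have hN : (0 : ℝ) < N + 1 := by positivity
    calc _ = (N + 1) * Real.exp (-s) := by
          rw [Real.exp_neg]; field_simp
      _ ≤ _ := by
          gcongr
          push_cast at h1
          linarith

end Main

end SpinBell

theorem theorem9 (N : ℕ) (R J : ℝ) :
    ∃ c κ v : ℝ, 0 < c ∧ 0 < κ ∧ 0 < v ∧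
      ∀ (Ω : Type) [Fintype Ω] [DecidableEq Ω] [MetricSpace Ω],
      (∀ x : Ω, (Metric.closedBall x R).ncard ≤ N) →
      ∀ (d : Ω → ℕ) (h : Finset Ω → Matrix (SpinBell.Config d) (SpinBell.Config d) ℂ),
      SpinBell.IsInteraction R J h →
      ∀ ρ : ∀ x, Matrix (Fin (d x)) (Fin (d x)) ℂ, (∀ x, SpinBell.IsDensity (ρ x)) →
      ∀ t : ℝ, 0 ≤ t →
      ∀ n : ℕ, 2 ≤ n → ∀ X : Fin n → Finset Ω, (∀ i, (X i).Nonempty) →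
      (∀ i j, i ≠ j → Disjoint (X i) (X j)) →
      ∀ (m : Fin n → ℕ) (ψ : SpinBell.BellCoeff n m),
      SpinBell.IsEpsLocal (SpinBell.RegionConfig d X) ψ
        (SpinBell.regionState X
          (SpinBell.evolve (SpinBell.hamiltonian h) t (SpinBell.productState ρ)))
        (SpinBell.muHat X ψ * c * Real.exp (-κ * SpinBell.minRegionDist X) *
          (Real.exp (κ * v * t) - 1)) := by
  set J' := |J| + 1 with hJ'
  have hJ'0 : 0 < J' := by positivity
  set R' := max R 1 with hR'
  have hR'0 : 0 < R' := lt_of_lt_of_le one_pos (le_max_right _ _)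
  set b : ℝ := (N + 1) * Real.exp 1 with hb
  have hb1 : 1 ≤ b := by
    have h1 := Real.one_le_exp (zero_le_one (α := ℝ))
    have h2 : (1 : ℝ) ≤ N + 1 := by linarith [(Nat.cast_nonneg N : (0 : ℝ) ≤ N)]
    nlinarith
  have hb0 : 0 < b := by linarith
  set V := 4 * J' * (N * 2 ^ N + 1) * b with hV
  have hV0 : 0 < V := by positivity
  refine ⟨2 ^ N * (2 * J') / V * ((N + 1) * Real.exp 2), 1 / (2 * R'), V * (2 * R'),
    by positivity, by positivity, by positivity, ?_⟩
  intro Ω _ _ _ hN d h hh ρ hρ t ht n hn X hXne hX m ψ Δ hΔ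
  have hh' : SpinBell.IsInteraction R J' h := ⟨hh.hermitian, hh.supported, hh.range,
    fun Z => (hh.strength Z).trans (by rw [hJ']; linarith [le_abs_self J])⟩
  have : Nonempty (Fin n) := ⟨⟨0, by omega⟩⟩
  obtain ⟨i₀, hi₀⟩ := Finite.exists_min fun i => (X i).card
  set τ := SpinBell.minRegionDist X with hτ
  have hτ0 : 0 ≤ τ := SpinBell.minRegionDist_nonneg X
  set r := ⌊τ / (2 * R')⌋₊ with hr
  have hrle : 2 * r * R' ≤ τ := by
    have := Nat.floor_le (a := τ / (2 * R')) (by positivity)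
    rw [le_div_iff₀ (by positivity)] at this
    linarith
  obtain ⟨σ, hσ, hclose⟩ := SpinBell.exists_biseparable_correlator_sub_le hJ'0 (le_max_left R 1)
    hR'0 hN hh' hρ ht hn hX i₀ r hrle hb1
  set c := 2 ^ N * (2 * J') / V * ((N + 1) * Real.exp 2) with hc
  set e := c * Real.exp (-(1 / (2 * R')) * τ) * (Real.exp (V * t) - 1) with he
  have hexp : 0 ≤ Real.exp (V * t) - 1 := by
    have := Real.one_le_exp (show 0 ≤ V * t by positivity)
    linarith
  have he0 : 0 ≤ e := by positivity
  have hδ : ((X i₀).card * ((N : ℝ) + 1) ^ r * 2 ^ N) * (2 * J' * (b ^ (r - 1))⁻¹) / V *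
      (Real.exp (V * t) - 1) ≤ (X i₀).card * e := by
    have := SpinBell.pow_floor_mul_inv_pow_le N τ R'
    calc _ = (X i₀).card * (2 ^ N * (2 * J') / V * (((N : ℝ) + 1) ^ r * (b ^ (r - 1))⁻¹) *
          (Real.exp (V * t) - 1)) := by ring
      _ ≤ (X i₀).card * (2 ^ N * (2 * J') / V * ((N + 1) * Real.exp 2 *
          Real.exp (-(1 / (2 * R')) * τ)) * (Real.exp (V * t) - 1)) := by gcongr
      _ = _ := by rw [he, hc]; ring
  have hmain : ∀ x ∈ SpinBell.bellValues (SpinBell.RegionConfig d X) ψ (SpinBell.regionState X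
      (SpinBell.evolve (SpinBell.hamiltonian h) t (SpinBell.productState ρ))),
      x ≤ Δ + SpinBell.muHat X ψ * c * Real.exp (-(1 / (2 * R')) * τ) *
        (Real.exp (1 / (2 * R') * (V * (2 * R')) * t) - 1) := by
    rintro _ ⟨E, hE, rfl⟩
    have h1 := hΔ σ hσ _ ⟨E, hE, rfl⟩
    have h2 : SpinBell.muHat X ψ * c * Real.exp (-(1 / (2 * R')) * τ) *
        (Real.exp (1 / (2 * R') * (V * (2 * R')) * t) - 1) = SpinBell.muHat X ψ * e := by
      rw [show 1 / (2 * R') * (V * (2 * R')) = V by field_simp, he]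
      ring
    rw [h2, ← sub_le_iff_le_add]
    refine le_trans ?_ h1
    rw [sub_le_iff_le_add, ← sub_le_iff_le_add']
    simp only [SpinBell.bellExpr, SpinBell.muHat, Finset.sum_mul, ← Finset.sum_sub_distrib]
    refine Finset.sum_le_sum fun s hs => Finset.sum_le_sum fun I _ =>
      Finset.sum_le_sum fun k _ => ?_
    have h3 := (hclose m E hE s I k).trans hδ
    have h4 : ((X i₀).card : ℝ) ≤ ∏ j, ((X (I j)).card : ℝ) := by
      have hs1 : 1 ≤ s := (Finset.mem_Icc.1 hs).1
      have h5 : (X i₀).card ≤ ∏ j, (X (I j)).card :=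
        (hi₀ (I ⟨0, hs1⟩)).trans (Finset.single_le_prod' (f := fun j => (X (I j)).card)
          (fun j _ => (hXne (I j)).card_pos) (Finset.mem_univ _))
      exact_mod_cast h5
    rw [← mul_sub]
    calc _ ≤ |ψ s I k| * ((X i₀).card * e) := by
          refine (le_abs_self _).trans ?_
          rw [abs_mul]
          gcongr
      _ ≤ |ψ s I k| * ((∏ j, ((X (I j)).card : ℝ)) * e) := by gcongr
      _ = _ := by ring
  refine ⟨⟨_, hmain⟩, csSup_le ⟨_, 0, fun i k => ?_, rfl⟩ hmain⟩
  simp
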